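/- **Definitions.** A *scalable group* is a topological group $G$ with identity $e$ and a continuous map $\delta:\mathbb R\times G\to G$, $\delta_\lambda=\delta(\lambda,\cdot)$, such that $\delta_\lambda\in\mathrm{Aut}(G)$ for $\lambda\neq 0$, $\delta_\lambda\circ\delta_\mu=\delta_{\lambda\mu}$ for all $\lambda,\mu\in\mathbb R$, and $\delta_0\equiv e$. A *metric scalable group* is a scalable group with a left-invariant distance $d$ that induces its topology and satisfies $d(\delta_t(p),\delta_t(q))=|t|\,d(p,q)$ for all $t\in\mathbb R$, $p,q\in G$; it is *complete* if $d$ is. A subgroup $H$ of $G$ is *scalable* if $\delta_\lambda(H)=H$ for all $\lambda\ne0$. A *Carnot group* is a simply connected (finite-dimensional, real) Lie group whose Lie algebra is equipped with a stratification $\bigoplus_{k\geq 1}V_k$, $[V_1,V_k]=V_{k+1}$ for all $k\ge1$; its dilation of factor $t$ is the Lie group homomorphism whose differential is $t^k\,\mathrm{id}$ on $V_k$ for every $k$. A scalable group *has a Carnot group structure* if it is isomorphic, as a topological group, to a Carnot group by an isomorphism that carries $\delta_t$ to the dilation of factor $t$ for every $t$. A *filtration by Carnot subgroups* of a scalable group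 $G$ is a sequence $(N_m)_{m\in\mathbb N}$ of scalable subgroups of $G$, each with a Carnot group structure, such that $N_m\le N_{m+1}$ for all $m$ and $\bigcup_m N_m$ is dense in $G$. Given such a filtration, a Borel set $\Omega\subseteq G$ is *$(N_m)_m$-negligible* if $\Omega=\bigcup_{m\in\mathbb N}\Omega_m$ for Borel sets $\Omega_m$ such that $\operatorname{vol}_{N_m}(N_m\cap g\Omega_m)=0$ for all $m\in\mathbb N$ and $g\in G$, where $\operatorname{vol}_{N_m}$ is any Haar measure on $N_m$. A function $f:G\to\mathbb R$ is *Gâteaux differentiable* at $p\in G$ if there is a continuous homomorphism $D:G\to(\mathbb R,+)$ such that $\lim_{\lambda\to0}\frac{f(p\,\delta_\lambda(u))-f(p)}{\lambda}=D(u)$ for every $u\in G$. **Proposition 1.6.** Let $G$ be a complete metric scalable group and let $(N_m)_{m\in\mathbb N}$ be a filtration of $G$ by Carnot subgroups. 1. Every Borel $(N_m)_m$-negligible set $\Omega\subseteq G$ has empty interior. 2. Consequently, every Lipschitz function $f:G\to\mathbb R$ has at least one point of Gâteaux differentiability. -/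

import Mathlib

open Set Filter Topology MeasureTheory
open scoped Manifold ContDiff Pointwise

universe u v

/-- A scalable group: a topological group with a continuous map `δ : ℝ × G → G`, written
`dil t x`, such that `δ_t` is an automorphism for `t ≠ 0`, `δ_s ∘ δ_t = δ_{st}` for all real
`s, t`, and `δ_0` is constantly the identity. (Continuity of the inverse of `δ_t` and `δ_1 = id`
follow from these axioms.) -/
class ScalableGroup (G : Type u) [Group G] [TopologicalSpace G] [IsTopologicalGroup G] where
  dil : ℝ → G → G
  continuous_dil : Continuous fun q : ℝ × G => dil q.1 q.2
  dil_mul : ∀ t : ℝ, t ≠ 0 → ∀ x y : G, dil t (x * y) = dil t x * dil t y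
  bijective_dil : ∀ t : ℝ, t ≠ 0 → Function.Bijective (dil t)
  dil_dil : ∀ (s t : ℝ) (x : G), dil s (dil t x) = dil (s * t) x
  dil_zero : ∀ x : G, dil 0 x = 1

/-- A metric scalable group: a scalable group whose topology is given by a left-invariant
distance that `δ_t` multiplies by `|t|`. -/
class MetricScalableGroup (G : Type u) [Group G] [MetricSpace G] [IsTopologicalGroup G]
    [ScalableGroup G] : Prop where
  dist_mul_left : ∀ g x y : G, dist (g * x) (g * y) = dist x y
  dist_dil : ∀ (t : ℝ) (x y : G),
    dist (ScalableGroup.dil t x) (ScalableGroup.dil t y) = |t| * dist x y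

/-- The additive group of the reals, with the dilations `x ↦ t x`, as a scalable group. -/
instance instScalableGroupReal : ScalableGroup (Multiplicative ℝ) where
  dil t x := Multiplicative.ofAdd (t * x.toAdd)
  continuous_dil :=
    continuous_ofAdd.comp (continuous_fst.mul (continuous_toAdd.comp continuous_snd))
  dil_mul t _ x y := by
    rw [toAdd_mul, mul_add, ofAdd_add]
  bijective_dil t ht :=
    Multiplicative.ofAdd.bijective.comp
      ((mulLeft_bijective₀ t ht).comp Multiplicative.toAdd.bijective)
  dil_dil s t x := by
    rw [toAdd_ofAdd, mul_assoc]
  dil_zero x := by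
    rw [zero_mul, ofAdd_zero]

/-- The continuous homomorphism `D` is the Gâteaux differential of `f` at `p`: as `t → 0`, the maps
`δ_{1/t} ∘ L_{f(p)}⁻¹ ∘ f ∘ L_p ∘ δ_t` converge pointwise to `D`. -/
def HasGateauxDifferentialAt {G : Type u} {H : Type v}
    [Group G] [TopologicalSpace G] [IsTopologicalGroup G] [ScalableGroup G]
    [Group H] [TopologicalSpace H] [IsTopologicalGroup H] [ScalableGroup H]
    (f : G → H) (D : G →ₜ* H) (p : G) : Prop :=
  ∀ u : G, Tendsto
    (fun t : ℝ => ScalableGroup.dil (1 / t) ((f p)⁻¹ * f (p * ScalableGroup.dil t u)))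
    (𝓝[≠] 0) (𝓝 (D u))

/-- Gâteaux differentiability of a map between scalable groups at a point. -/
def GateauxDifferentiableAt {G : Type u} {H : Type v}
    [Group G] [TopologicalSpace G] [IsTopologicalGroup G] [ScalableGroup G]
    [Group H] [TopologicalSpace H] [IsTopologicalGroup H] [ScalableGroup H]
    (f : G → H) (p : G) : Prop :=
  ∃ D : G →ₜ* H, HasGateauxDifferentialAt f D p

/-- A subgroup `H` is scalable if `δ_t(H) = H` for all `t ≠ 0`. -/
def IsScalableSubgroup {G : Type u} [Group G] [TopologicalSpace G] [IsTopologicalGroup G]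
    [ScalableGroup G] (H : Subgroup G) : Prop :=
  ∀ t : ℝ, t ≠ 0 → ScalableGroup.dil t '' (H : Set G) = (H : Set G)

theorem IsScalableSubgroup.dil_mem {G : Type u} [Group G] [TopologicalSpace G]
    [IsTopologicalGroup G] [ScalableGroup G] {H : Subgroup G} (hH : IsScalableSubgroup H)
    (t : ℝ) {x : G} (hx : x ∈ H) : ScalableGroup.dil t x ∈ H := by
  rcases eq_or_ne t 0 with rfl | ht
  · rw [ScalableGroup.dil_zero]
    exact H.one_mem
  · have h : ScalableGroup.dil t x ∈ ScalableGroup.dil t '' (H : Set G) := mem_image_of_mem _ hx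
    rw [hH t ht] at h
    exact h

/-- A scalable subgroup, with the subspace topology and the restricted dilations, is a scalable
group. -/
@[reducible]
def IsScalableSubgroup.scalableGroup {G : Type u} [Group G] [TopologicalSpace G]
    [IsTopologicalGroup G] [ScalableGroup G] {H : Subgroup G} (hH : IsScalableSubgroup H) :
    ScalableGroup H where
  dil t x := ⟨ScalableGroup.dil t (x : G), hH.dil_mem t x.2⟩
  continuous_dil := Continuous.subtype_mk
    (ScalableGroup.continuous_dil.comp
      (continuous_fst.prodMk (continuous_subtype_val.comp continuous_snd))) _
  dil_mul t ht x y := Subtype.ext (ScalableGroup.dil_mul t ht (x : G) (y : G))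
  bijective_dil t ht := by
    constructor
    · intro x y hxy
      exact Subtype.ext ((ScalableGroup.bijective_dil t ht).1 (congrArg Subtype.val hxy))
    · intro y
      have hy : (y : G) ∈ ScalableGroup.dil t '' (H : Set G) := by
        rw [hH t ht]
        exact y.2
      obtain ⟨x, hx, hxy⟩ := hy
      exact ⟨⟨x, hx⟩, Subtype.ext hxy⟩
  dil_dil s t x := Subtype.ext (ScalableGroup.dil_dil s t (x : G))
  dil_zero x := Subtype.ext (ScalableGroup.dil_zero (x : G))

/-- A stratification of the Lie algebra of an `n`-dimensional Lie group `C`: the Lie algebra is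
the direct sum of the layers, and the bracket of the first layer with any layer spans the next one.
Here `V k` is the layer of degree `k + 1`; since the Lie algebra has finite dimension, all but
finitely many layers are zero. -/
structure IsStratification (n : ℕ) (C : Type u) [Group C] [TopologicalSpace C]
    [ChartedSpace (EuclideanSpace ℝ (Fin n)) C]
    (V : ℕ → Submodule ℝ (GroupLieAlgebra (𝓡 n) C)) : Prop where
  isInternal : DirectSum.IsInternal V
  span_bracket : ∀ k : ℕ, Submodule.span ℝ
    {Z : GroupLieAlgebra (𝓡 n) C | ∃ X ∈ V 0, ∃ Y ∈ V k, ⁅X, Y⁆ = Z} = V (k + 1)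

/-- The homomorphism `ζ` of the Lie group `C` is the dilation of factor `t` given by the
stratification `V`: it is smooth and its differential at the identity is multiplication by `t ^ j`
on the layer of degree `j`. -/
structure IsCarnotDilation (n : ℕ) (C : Type u) [Group C] [TopologicalSpace C]
    [ChartedSpace (EuclideanSpace ℝ (Fin n)) C]
    (V : ℕ → Submodule ℝ (GroupLieAlgebra (𝓡 n) C)) (t : ℝ) (ζ : C →* C) : Prop where
  contMDiff : ContMDiff (𝓡 n) (𝓡 n) ∞ ζ
  mfderiv_eq : ∀ k : ℕ, ∀ X ∈ V k,
    (mfderiv (𝓡 n) (𝓡 n) ζ (1 : C) X : EuclideanSpace ℝ (Fin n)) = t ^ (k + 1) • X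

/-- A scalable group `N` has a Carnot group structure: there are a simply connected
(finite-dimensional, real, smooth) Lie group `C` with a stratification of its Lie algebra, and an
isomorphism of topological groups `N ≃ C` that carries the dilations of `N` to those given by the
stratification. -/
def HasCarnotGroupStructure (N : Type u) [Group N] [TopologicalSpace N] [IsTopologicalGroup N]
    [ScalableGroup N] : Prop :=
  ∃ (n : ℕ) (C : Type u) (_ : Group C) (_ : TopologicalSpace C)
    (_ : ChartedSpace (EuclideanSpace ℝ (Fin n)) C) (_ : LieGroup (𝓡 n) ∞ C)
    (_ : SimplyConnectedSpace C)
    (V : ℕ → Submodule ℝ (GroupLieAlgebra (𝓡 n) C)) (ζ : ℝ → C →* C) (φ : N ≃ₜ* C),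
    IsStratification n C V ∧ (∀ t : ℝ, IsCarnotDilation n C V t (ζ t)) ∧
      ∀ (t : ℝ) (x : N), φ (ScalableGroup.dil t x) = ζ t (φ x)

/-- A filtration by Carnot subgroups of a scalable group: an increasing sequence of scalable
subgroups, each with a Carnot group structure, whose union is dense. -/
structure IsCarnotFiltration {G : Type u} [Group G] [TopologicalSpace G] [IsTopologicalGroup G]
    [ScalableGroup G] (N : ℕ → Subgroup G) : Prop where
  isScalable : ∀ m, IsScalableSubgroup (N m)
  hasCarnot : ∀ m, @HasCarnotGroupStructure (N m) _ _ _ (isScalable m).scalableGroup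
  le_succ : ∀ m, N m ≤ N (m + 1)
  closure_eq : closure (⋃ m, (N m : Set G)) = univ

/-- A Borel set `Ω` is `(N_m)`-negligible: it is a union of Borel sets `A_m` such that, for all
`m` and all `g ∈ G`, the set `N_m ∩ g A_m` is null for the Haar measures of `N_m`. -/
def IsFiltrationNegligible {G : Type u} [Group G] [TopologicalSpace G]
    [MeasurableSpace G] (N : ℕ → Subgroup G) (Ω : Set G) : Prop :=
  MeasurableSet Ω ∧ ∃ A : ℕ → Set G, (∀ m, MeasurableSet (A m)) ∧ Ω = ⋃ m, A m ∧
    ∀ (m : ℕ) (g : G) (vol : Measure (N m)), vol.IsHaarMeasure →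
      vol ((fun x : N m => (x : G)) ⁻¹' (g • A m)) = 0

/-!
Both statements rest on measures on the locally compact groups `N m`.

A negligible set has empty interior because each ball of `G` carries a probability measure that
charges no negligible set. It is a left translate of the law of an infinite product `⋯ x_2 x_1 x_0`
of independent random elements `x_m ∈ N m` with densities with respect to Haar measure and supports
so small that the product converges (`exists_compact_sequence`). When all coordinates but `x_m` are
fixed, the product is `g x_m h` with `h ∈ N m`, since `h` only involves lower coordinates and the
`N m` increase; the right translation by `h` preserves the null sets of `N m`, so the slices of
`A m` are null (`interior_eq_empty_of_isFiltrationNegligible`).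

For the second statement it is enough that the points where `f` is not differentiable along `N m`
form a null set in each left coset of `N m`, which is a Rademacher theorem for real functions on a
Carnot group. Along a horizontal one-parameter subgroup it follows from Fubini's theorem
(`ae_hasDirDeriv_of_isHorizontal`). A density point argument, valid because Haar measure is
doubling for a homogeneous distance, shows that derivatives in the direction `v` make the
difference quotients additive, `D (u v) = D u + D v`, at almost every point (`ae_isAdditiveAt`). So
the directions of almost everywhere differentiability form a subgroup, and the horizontal elements
generate a Carnot group (`HasCarnotGroupStructure.closure_isHorizontal`). At a point outside the
exceptional sets of a countable dense set of directions, the derivative extends to `G` by density.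

That horizontal elements generate is proved without an exponential map. Among the ranges at `0` of
the differentials of strictly differentiable maps into the subgroup `L` that they generate there is
a largest one, `W`. It contains the first layer, as integral curves of its left-invariant fields
are horizontal one-parameter subgroups, and it is invariant under conjugation by `L`.
Differentiating this invariance along these curves gives `[V_1, W] ⊆ W`
(`bracket_mem_of_invariant`). Hence `W` is everything, so that `L` is open
(`subgroup_eq_top_of_oneParameter`).
-/

/-! ### Integral curves of left-invariant vector fields -/

section Lie
variable {n : ℕ} {C : Type*} [Group C] [TopologicalSpace C]
  [ChartedSpace (EuclideanSpace ℝ (Fin n)) C] [LieGroup (𝓡 n) ∞ C]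

theorem lieGroup_minSmoothness_three : LieGroup (𝓡 n) (minSmoothness ℝ 3) C := by
  apply LieGroup.of_le (n := ∞)
  simp only [minSmoothness_of_isRCLikeNormedField]
  exact WithTop.coe_le_coe.2 (le_top : (3 : ℕ∞) ≤ ⊤)

theorem contMDiff_one_mulInvariantVectorField (X : GroupLieAlgebra (𝓡 n) C) :
    ContMDiff (𝓡 n) (𝓡 n).tangent 1
      (fun g : C => (⟨g, mulInvariantVectorField X g⟩ : TangentBundle (𝓡 n) C)) := by
  have : LieGroup (𝓡 n) (minSmoothness ℝ 3) C := lieGroup_minSmoothness_three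
  refine (contMDiff_mulInvariantVectorField X).of_le ?_
  simp only [minSmoothness_of_isRCLikeNormedField]
  norm_num

/-- If `f (g * h) = f g * ρ h` and the differential of `ρ` at the identity sends `X` to `X'`, then
`f` pushes the left-invariant field of `X` forward to that of `X'`. Both left translations
(`ρ = id`) and homomorphisms (`ρ = f`) are covered. -/
theorem mfderiv_mulInvariantVectorField_of_equivariant {f ρ : C → C}
    (hf : ContMDiff (𝓡 n) (𝓡 n) ∞ f)
    (hρ : ContMDiff (𝓡 n) (𝓡 n) ∞ ρ) (h1 : ρ 1 = 1) (hfρ : ∀ g h, f (g * h) = f g * ρ h)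
    {X X' : GroupLieAlgebra (𝓡 n) C}
    (hX : (mfderiv (𝓡 n) (𝓡 n) ρ (1 : C) X : EuclideanSpace ℝ (Fin n)) = X') (g : C) :
    mfderiv (𝓡 n) (𝓡 n) f g (mulInvariantVectorField X g) =
      mulInvariantVectorField X' (f g) := by
  -- Both sides of `f (g * h) = f g * ρ h` are differentiated in `h` at the identity.
  have e1 : HasMFDerivAt (𝓡 n) (𝓡 n) (fun h => f (g * h)) (1 : C)
      ((mfderiv (𝓡 n) (𝓡 n) f (g * 1)).comp (mfderiv (𝓡 n) (𝓡 n) (fun h => g * h) (1 : C))) :=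
    HasMFDerivAt.comp (1 : C) ((hf.mdifferentiable (by simp)) (g * 1)).hasMFDerivAt
      (((contMDiff_mul_left (I := 𝓡 n) (n := ∞) (a := g)).mdifferentiable (by simp)) 1).hasMFDerivAt
  have e2 : HasMFDerivAt (𝓡 n) (𝓡 n) (fun h => f g * ρ h) (1 : C)
      ((mfderiv (𝓡 n) (𝓡 n) (fun h => f g * h) (ρ 1)).comp (mfderiv (𝓡 n) (𝓡 n) ρ (1 : C))) :=
    HasMFDerivAt.comp (1 : C)
      (((contMDiff_mul_left (I := 𝓡 n) (n := ∞) (a := f g)).mdifferentiable (by simp))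
        (ρ 1)).hasMFDerivAt
      ((hρ.mdifferentiable (by simp)) 1).hasMFDerivAt
  rw [h1] at e2
  have e3 : (fun h => f (g * h)) = (fun h => f g * ρ h) := funext fun h => hfρ g h
  rw [e3] at e1
  have e4 := congrArg (fun T => T X) (hasMFDerivAt_unique e1 e2)
  rw [mul_one] at e4
  have e5 : mfderiv (𝓡 n) (𝓡 n) (fun h => f g * h) (1 : C) X' = mulInvariantVectorField X' (f g) :=
    rfl
  rw [← e5]
  refine Eq.trans e4 ?_
  exact congrArg (mfderiv (𝓡 n) (𝓡 n) (fun h => f g * h) (1 : C)) hX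

theorem IsMIntegralCurveOn.comp_of_equivariant {f ρ : C → C}
    (hf : ContMDiff (𝓡 n) (𝓡 n) ∞ f)
    (hρ : ContMDiff (𝓡 n) (𝓡 n) ∞ ρ) (h1 : ρ 1 = 1) (hfρ : ∀ g h, f (g * h) = f g * ρ h)
    {X X' : GroupLieAlgebra (𝓡 n) C}
    (hX : (mfderiv (𝓡 n) (𝓡 n) ρ (1 : C) X : EuclideanSpace ℝ (Fin n)) = X')
    {γ : ℝ → C} {s : Set ℝ} (hγ : IsMIntegralCurveOn (I := 𝓡 n) γ (mulInvariantVectorField X) s) :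
    IsMIntegralCurveOn (I := 𝓡 n) (f ∘ γ) (mulInvariantVectorField X') s := by
  intro t ht
  have := HasMFDerivAt.comp_hasMFDerivWithinAt t
    ((hf.mdifferentiable (by simp)) (γ t)).hasMFDerivAt (hγ t ht)
  have e : (1 : ℝ →L[ℝ] ℝ).smulRight (mulInvariantVectorField X' ((f ∘ γ) t)) =
      (mfderiv (𝓡 n) (𝓡 n) f (γ t)).comp
        ((1 : ℝ →L[ℝ] ℝ).smulRight (mulInvariantVectorField X (γ t))) := by
    rw [Function.comp_apply, ← mfderiv_mulInvariantVectorField_of_equivariant hf hρ h1 hfρ hX]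
    exact ContinuousLinearMap.ext fun r =>
      (map_smul (mfderiv (𝓡 n) (𝓡 n) f (γ t)) r (mulInvariantVectorField X (γ t))).symm
  rw [e]
  exact this

variable [T2Space C]

/-- Left-invariant vector fields are complete: left translation gives every point the same existence
time as the identity. -/
theorem exists_isMIntegralCurve_mulInvariantVectorField (X : GroupLieAlgebra (𝓡 n) C) :
    ∃ γ : ℝ → C, γ 0 = 1 ∧ IsMIntegralCurve (I := 𝓡 n) γ (mulInvariantVectorField X) := by
  have : IsManifold (𝓡 n) 1 C := IsManifold.of_le (n := ∞) (by exact_mod_cast le_top)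
  obtain ⟨γ, h0, hγ⟩ := exists_isMIntegralCurveAt_of_contMDiffAt_boundaryless (I := 𝓡 n) (t₀ := 0)
    (contMDiff_one_mulInvariantVectorField X (1 : C))
  rw [isMIntegralCurveAt_iff'] at hγ
  obtain ⟨ε, hε, hγ⟩ := hγ
  refine exists_isMIntegralCurve_of_isMIntegralCurveOn
    (contMDiff_one_mulInvariantVectorField X) hε (fun x => ⟨(fun g => x * g) ∘ γ, ?_, ?_⟩) 1
  · simp [h0]
  · have := hγ.comp_of_equivariant (f := fun g => x * g) (ρ := id) (X' := X) contMDiff_mul_left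
      contMDiff_id rfl (fun g h => by simp [mul_assoc]) (by rw [mfderiv_id]; rfl)
    simpa [Real.ball_eq_Ioo] using this

/-- Every `X` in the Lie algebra generates a one-parameter subgroup, and a homomorphism whose
differential multiplies `X` by `c` acts on it by `t ↦ c * t`. Both identities are instances of the
uniqueness of integral curves. -/
theorem exists_oneParameterSubgroup (X : GroupLieAlgebra (𝓡 n) C) :
    ∃ γ : ℝ → C, γ 0 = 1 ∧ IsMIntegralCurve (I := 𝓡 n) γ (mulInvariantVectorField X) ∧
      (∀ s t, γ (s + t) = γ s * γ t) ∧
      ∀ (c : ℝ) (ζ : C →* C), ContMDiff (𝓡 n) (𝓡 n) ∞ ζ →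
        (mfderiv (𝓡 n) (𝓡 n) ζ (1 : C) X : EuclideanSpace ℝ (Fin n)) = c • X →
        ∀ t, ζ (γ t) = γ (c * t) := by
  have : IsManifold (𝓡 n) 1 C := IsManifold.of_le (n := ∞) (by exact_mod_cast le_top)
  obtain ⟨γ, h0, hγ⟩ := exists_isMIntegralCurve_mulInvariantVectorField X
  refine ⟨γ, h0, hγ, fun s t => ?_, fun c ζ hζ hX t => ?_⟩
  · have e1 := hγ.comp_add s
    have e2 : IsMIntegralCurve (I := 𝓡 n) ((fun g => γ s * g) ∘ γ) (mulInvariantVectorField X) := by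
      rw [isMIntegralCurve_iff_isMIntegralCurveOn] at hγ ⊢
      exact hγ.comp_of_equivariant (f := fun g => γ s * g) (ρ := id) (X' := X) contMDiff_mul_left
        contMDiff_id rfl (fun g h => by simp [mul_assoc]) (by rw [mfderiv_id]; rfl)
    have := isMIntegralCurve_Ioo_eq_of_contMDiff_boundaryless (t₀ := 0)
      (contMDiff_one_mulInvariantVectorField X) e1 e2 (by simp [h0])
    have := congrFun this t
    simpa [add_comm] using this
  · have e1 := hγ.comp_mul c
    have : LieGroup (𝓡 n) (minSmoothness ℝ 3) C := lieGroup_minSmoothness_three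
    rw [← mulInvariantVectorField_smul] at e1
    have e2 : IsMIntegralCurve (I := 𝓡 n) (ζ ∘ γ) (mulInvariantVectorField (c • X)) := by
      rw [isMIntegralCurve_iff_isMIntegralCurveOn] at hγ ⊢
      exact hγ.comp_of_equivariant hζ hζ (map_one ζ) (map_mul ζ) hX
    have := isMIntegralCurve_Ioo_eq_of_contMDiff_boundaryless (t₀ := 0)
      (contMDiff_one_mulInvariantVectorField (c • X)) e2 e1 (by simp [h0])
    have := congrFun this t
    simpa [mul_comm] using this

end Lie

/-! ### The Lie bracket of a local group law -/

section Calc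
variable {E : Type*} [NormedAddCommGroup E] [NormedSpace ℝ E]

theorem fderiv_right_eq {m : E × E → E} {x y : E} (h : DifferentiableAt ℝ m (x, y)) :
    fderiv ℝ (fun z => m (x, z)) y = (fderiv ℝ m (x, y)).comp (ContinuousLinearMap.inr ℝ E E) :=
  (h.hasFDerivAt.comp y (hasFDerivAt_prodMk_right x y)).fderiv

theorem fderiv_left_eq {m : E × E → E} {x y : E} (h : DifferentiableAt ℝ m (x, y)) :
    fderiv ℝ (fun z => m (z, y)) x = (fderiv ℝ m (x, y)).comp (ContinuousLinearMap.inl ℝ E E) :=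
  (h.hasFDerivAt.comp x (hasFDerivAt_prodMk_left x y)).fderiv

theorem eventually_differentiableAt {F : Type*} [NormedAddCommGroup F] [NormedSpace ℝ F]
    {m : F → E} {z : F} (h : ContDiffAt ℝ 2 m z) : ∀ᶠ w in 𝓝 z, DifferentiableAt ℝ m w :=
  (h.eventually (by simp)).mono fun _ hw => hw.differentiableAt (by simp)

theorem hasFDerivAt_fderiv_right {m : E × E → E} {a : E} (h : ContDiffAt ℝ 2 m (a, a)) (Y : E) :
    HasFDerivAt (fun x => fderiv ℝ (fun z => m (x, z)) a Y)
      ((fderiv ℝ (fderiv ℝ m) (a, a)).flip (0, Y) ∘L ContinuousLinearMap.inl ℝ E E) a := by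
  have h2 : DifferentiableAt ℝ (fderiv ℝ m) (a, a) :=
    (h.fderiv_right (m := 1) (by norm_num)).differentiableAt (by simp)
  have h3 : HasFDerivAt (fun x => fderiv ℝ m (x, a) (0, Y))
      ((fderiv ℝ (fderiv ℝ m) (a, a)).flip (0, Y) ∘L ContinuousLinearMap.inl ℝ E E) a := by
    have := (HasFDerivAt.comp (f := fun x : E => (x, a)) a h2.hasFDerivAt
      (hasFDerivAt_prodMk_left a a)).clm_apply
      (hasFDerivAt_const ((0 : E), Y) a)
    convert! this using 1
    ext x; simp
  refine h3.congr_of_eventuallyEq ?_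
  have hc : Tendsto (fun x : E => (x, a)) (𝓝 a) (𝓝 (a, a)) :=
    (continuous_id.prodMk continuous_const).tendsto a
  filter_upwards [hc.eventually (eventually_differentiableAt h)] with x hx
  rw [fderiv_right_eq hx]
  simp

theorem hasFDerivAt_fderiv_left {m : E × E → E} {a : E} (h : ContDiffAt ℝ 2 m (a, a)) (Y : E) :
    HasFDerivAt (fun x => fderiv ℝ (fun z => m (z, x)) a Y)
      ((fderiv ℝ (fderiv ℝ m) (a, a)).flip (Y, 0) ∘L ContinuousLinearMap.inr ℝ E E) a := by
  have h2 : DifferentiableAt ℝ (fderiv ℝ m) (a, a) :=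
    (h.fderiv_right (m := 1) (by norm_num)).differentiableAt (by simp)
  have h3 : HasFDerivAt (fun x => fderiv ℝ m (a, x) (Y, 0))
      ((fderiv ℝ (fderiv ℝ m) (a, a)).flip (Y, 0) ∘L ContinuousLinearMap.inr ℝ E E) a := by
    have := (h2.hasFDerivAt.comp a (hasFDerivAt_prodMk_right a a)).clm_apply
      (hasFDerivAt_const (Y, (0 : E)) a)
    convert! this using 1
    ext x; simp
  refine h3.congr_of_eventuallyEq ?_
  have hc : Tendsto (fun x : E => (a, x)) (𝓝 a) (𝓝 (a, a)) :=
    (continuous_const.prodMk continuous_id).tendsto a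
  filter_upwards [hc.eventually (eventually_differentiableAt h)] with x hx
  rw [fderiv_left_eq hx]
  simp

/-- Let `m` be a local group law near its identity element `a`, and let `c (x, y) = x⁻¹ y x` be the
associated conjugation. If the differentials at `a` of the conjugations by the points of a curve
`γ` with `γ' 0 = X` send `Y` into a subspace `W`, then `W` contains the Lie bracket of the
left-invariant vector fields `x ↦ ∂₂ m (x, a) X` and `x ↦ ∂₂ m (x, a) Y`. Up to sign this bracket is
the derivative of the conjugation in the direction `X`. -/
theorem chartBracket_mem_of_conj_mem [FiniteDimensional ℝ E] {m c : E × E → E} {a : E}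
    (hm : ContDiffAt ℝ 2 m (a, a)) (hc : ContDiffAt ℝ 2 c (a, a))
    (hma : ∀ᶠ y in 𝓝 a, m (a, y) = y)
    (hca : ∀ᶠ x in 𝓝 a, c (x, a) = a) (hac : ∀ᶠ y in 𝓝 a, c (a, y) = y)
    (hmc : ∀ᶠ p in 𝓝 (a, a), m (p.1, c p) = m (p.2, p.1))
    {γ : ℝ → E} {X : E} (hγ0 : γ 0 = a) (hγ : HasDerivAt γ X 0) (W : Submodule ℝ E) {Y : E}
    (hW : ∀ᶠ t in 𝓝 0, fderiv ℝ (fun y => c (γ t, y)) a Y ∈ W) :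
    fderiv ℝ (fun x => fderiv ℝ (fun z => m (x, z)) a Y) a X -
      fderiv ℝ (fun x => fderiv ℝ (fun z => m (x, z)) a X) a Y ∈ W := by
  have hl : Tendsto (fun x : E => (x, a)) (𝓝 a) (𝓝 (a, a)) :=
    (continuous_id.prodMk continuous_const).tendsto a
  have hr : Tendsto (fun x : E => (a, x)) (𝓝 a) (𝓝 (a, a)) :=
    (continuous_const.prodMk continuous_id).tendsto a
  have hm2 : DifferentiableAt ℝ (fderiv ℝ m) (a, a) :=
    (hm.fderiv_right (m := 1) (by norm_num)).differentiableAt (by simp)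
  -- Differentiating `m (x, c (x, y)) = m (y, x)` in `y` gives `∂₂m(x,a) ∘ ∂₂c(x,a) = ∂₁m(a,x)`.
  have key : (fun x => fderiv ℝ m (x, a) (0, fderiv ℝ (fun y => c (x, y)) a Y)) =ᶠ[𝓝 a]
      fun x => fderiv ℝ (fun z => m (z, x)) a Y := by
    filter_upwards [hl.eventually (eventually_differentiableAt hm),
      hr.eventually (eventually_differentiableAt hm),
      hl.eventually (eventually_differentiableAt hc), hca,
      hl.eventually hmc.eventually_nhds] with x h1 h2 h3 h4 h5
    have e1 : (fun y => m (x, c (x, y))) =ᶠ[𝓝 a] fun y => m (y, x) :=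
      (Continuous.prodMk continuous_const continuous_id).continuousAt.eventually h5
    have h1' : DifferentiableAt ℝ m (x, c (x, a)) := by rwa [h4]
    have h3' : HasFDerivAt (fun y => c (x, y)) (fderiv ℝ (fun y => c (x, y)) a) a :=
      (h3.comp a (hasFDerivAt_prodMk_right (𝕜 := ℝ) x a).differentiableAt).hasFDerivAt
    have h6 : HasFDerivAt (fun y => m (x, c (x, y))) ((fderiv ℝ m (x, c (x, a))).comp
        ((0 : E →L[ℝ] E).prod (fderiv ℝ (fun y => c (x, y)) a))) a :=
      HasFDerivAt.comp (f := fun y => (x, c (x, y))) a h1'.hasFDerivAt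
        ((hasFDerivAt_const x a).prodMk h3')
    rw [← e1.fderiv_eq, h6.fderiv, h4]
    simp
  have hA := (hasFDerivAt_fderiv_right hc Y)
  set A' := (fderiv ℝ (fderiv ℝ c) (a, a)).flip (0, Y) ∘L ContinuousLinearMap.inl ℝ E E with hA'
  -- The derivative of `t ↦ ∂₂c(γ(t),a) Y` at `0` is a limit of difference quotients in `W`.
  have hAW : A' X ∈ W := by
    have h1 : HasDerivAt (fun t => fderiv ℝ (fun y => c (γ t, y)) a Y) (A' X) 0 := by
      rw [← hγ0] at hA
      have := hA.comp_hasDerivAt 0 hγ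
      rw [hγ0] at this
      exact this
    have h2 := h1.tendsto_slope
    have hcl : IsClosed (W : Set E) := W.closed_of_finiteDimensional
    refine hcl.mem_of_tendsto h2 ?_
    filter_upwards [nhdsWithin_le_nhds hW] with t ht
    rw [slope_def_module]
    exact W.smul_mem _ (W.sub_mem ht hW.self_of_nhds)
  have hM : HasFDerivAt (fun x => fderiv ℝ m (x, a) (0, fderiv ℝ (fun y => c (x, y)) a Y))
      ((fderiv ℝ (fderiv ℝ m) (a, a)).flip (0, Y) ∘L ContinuousLinearMap.inl ℝ E E + A') a := by
    have h1 := (HasFDerivAt.comp (f := fun x : E => (x, a)) a hm2.hasFDerivAt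
      (hasFDerivAt_prodMk_left a a)).clm_apply
      ((hasFDerivAt_const (𝕜 := ℝ) (0 : E) a).prodMk hA)
    have h2 : fderiv ℝ (fun y => c (a, y)) a = ContinuousLinearMap.id ℝ E := by
      have : (fun y => c (a, y)) =ᶠ[𝓝 a] id := hac
      rw [this.fderiv_eq, fderiv_id]
    have h3 : ∀ v, fderiv ℝ m (a, a) ((0 : E), v) = v := by
      have : (fun y => m (a, y)) =ᶠ[𝓝 a] id := hma
      have h4 := this.fderiv_eq (𝕜 := ℝ)
      rw [fderiv_right_eq (hm.differentiableAt (by simp)), fderiv_id] at h4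
      intro v
      simpa using congrArg (fun T => T v) h4
    convert! h1 using 1
    ext v
    simp [h2, h3, add_comm]
  have hR := hasFDerivAt_fderiv_left hm Y
  have hEq := hM.unique (hR.congr_of_eventuallyEq key)
  have hEqX := congrArg (fun T => T X) hEq
  -- The mixed second derivatives of `m` agree; this turns `∂₂∂₁m` into `∂₁∂₂m`.
  have hsymm : (fderiv ℝ (fderiv ℝ m) (a, a)) (0, X) (Y, 0) =
      (fderiv ℝ (fderiv ℝ m) (a, a)) (Y, 0) (0, X) :=
    (hm.isSymmSndFDerivAt (by simp)).eq _ _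
  rw [(hasFDerivAt_fderiv_right hm Y).fderiv, (hasFDerivAt_fderiv_right hm X).fderiv]
  simp only [add_apply, ContinuousLinearMap.comp_apply,
    ContinuousLinearMap.flip_apply, ContinuousLinearMap.inl_apply,
    ContinuousLinearMap.inr_apply] at hEqX ⊢
  rw [hsymm] at hEqX
  rw [← hEqX]
  simpa using W.neg_mem hAW
end Calc

/-! ### The group law in a chart at the identity -/

section Chart
variable {n : ℕ} (C : Type*) [Group C] [TopologicalSpace C]
  [ChartedSpace (EuclideanSpace ℝ (Fin n)) C]

/-- The group law of `C` read in the preferred chart at the identity. It has its meaning only near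
the image of the identity. -/
noncomputable def chartMul (p : EuclideanSpace ℝ (Fin n) × EuclideanSpace ℝ (Fin n)) :
    EuclideanSpace ℝ (Fin n) :=
  extChartAt (𝓡 n) (1 : C) ((extChartAt (𝓡 n) (1 : C)).symm p.1 *
    (extChartAt (𝓡 n) (1 : C)).symm p.2)

/-- The map `h ↦ g⁻¹ h g` read in the preferred chart at the identity. -/
noncomputable def chartConj (g : C) (y : EuclideanSpace ℝ (Fin n)) : EuclideanSpace ℝ (Fin n) :=
  extChartAt (𝓡 n) (1 : C) (g⁻¹ * (extChartAt (𝓡 n) (1 : C)).symm y * g)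

theorem contDiffAt_chart_comp [IsManifold (𝓡 n) ∞ C] {P : Type*} [NormedAddCommGroup P]
    [NormedSpace ℝ P] {F : P → C}
    {p : P} (hF : ContMDiffAt 𝓘(ℝ, P) (𝓡 n) ∞ F p)
    (h1 : F p = 1) :
    ContDiffAt ℝ ∞ (fun x => extChartAt (𝓡 n) (1 : C) (F x)) p := by
  rw [← contMDiffAt_iff_contDiffAt]
  have h2 : ContMDiffAt (𝓡 n) 𝓘(ℝ, EuclideanSpace ℝ (Fin n)) ∞ (extChartAt (𝓡 n) (1 : C))
      (F p) := by
    rw [h1]; exact contMDiffAt_extChartAt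
  exact h2.comp p hF

variable [LieGroup (𝓡 n) ∞ C]

theorem contMDiffAt_chart_symm : ContMDiffAt 𝓘(ℝ, EuclideanSpace ℝ (Fin n)) (𝓡 n) ∞
    (extChartAt (𝓡 n) (1 : C)).symm (extChartAt (𝓡 n) (1 : C) 1) :=
  (contMDiffOn_extChartAt_symm (1 : C)).contMDiffAt (extChartAt_target_mem_nhds (1 : C))

theorem contDiffAt_chartMul : ContDiffAt ℝ ∞ (chartMul C (n := n))
    (extChartAt (𝓡 n) (1 : C) 1, extChartAt (𝓡 n) (1 : C) 1) := by
  refine contDiffAt_chart_comp C (ContMDiffAt.mul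
    (ContMDiffAt.comp (g := (extChartAt (𝓡 n) (1 : C)).symm) (f := Prod.fst) _
      (contMDiffAt_chart_symm C) contDiffAt_fst.contMDiffAt)
    (ContMDiffAt.comp (g := (extChartAt (𝓡 n) (1 : C)).symm) (f := Prod.snd) _
      (contMDiffAt_chart_symm C) contDiffAt_snd.contMDiffAt)) (by simp)

theorem contDiffAt_chartConj (g : C) : ContDiffAt ℝ ∞ (chartConj C (n := n) g)
    (extChartAt (𝓡 n) (1 : C) 1) :=
  contDiffAt_chart_comp C ((contMDiffAt_const.mul (contMDiffAt_chart_symm C)).mul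
    contMDiffAt_const) (by simp)

theorem contDiffAt_chartConj_prod : ContDiffAt ℝ ∞
    (fun p : EuclideanSpace ℝ (Fin n) × EuclideanSpace ℝ (Fin n) =>
      chartConj C ((extChartAt (𝓡 n) (1 : C)).symm p.1) p.2)
    (extChartAt (𝓡 n) (1 : C) 1, extChartAt (𝓡 n) (1 : C) 1) := by
  have h1 := ContMDiffAt.comp (g := (extChartAt (𝓡 n) (1 : C)).symm) (f := Prod.fst)
      (extChartAt (𝓡 n) (1 : C) 1, extChartAt (𝓡 n) (1 : C) 1)
      (contMDiffAt_chart_symm C) contDiffAt_fst.contMDiffAt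
  have h2 := ContMDiffAt.comp (g := (extChartAt (𝓡 n) (1 : C)).symm) (f := Prod.snd)
      (extChartAt (𝓡 n) (1 : C) 1, extChartAt (𝓡 n) (1 : C) 1)
      (contMDiffAt_chart_symm C) contDiffAt_snd.contMDiffAt
  exact contDiffAt_chart_comp C ((h1.inv.mul h2).mul h1) (by simp)

/-- In the chart, the left-invariant vector field of `X` is `x ↦ ∂₂ m (x, a) X`, where `m` is the
group law in the chart and `a` the image of the identity. -/
theorem mpullbackWithin_eq_fderiv_chartMul (X : GroupLieAlgebra (𝓡 n) C) :
    ∀ᶠ x in 𝓝 (extChartAt (𝓡 n) (1 : C) 1),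
    VectorField.mpullbackWithin 𝓘(ℝ, EuclideanSpace ℝ (Fin n)) (𝓡 n)
      (extChartAt (𝓡 n) (1 : C)).symm (mulInvariantVectorField X) (range (𝓡 n)) x =
    fderiv ℝ (fun y => chartMul C (x, y)) (extChartAt (𝓡 n) (1 : C) 1) X := by
  filter_upwards [extChartAt_target_mem_nhds (I := 𝓡 n) (1 : C)] with x hx
  set ψ := extChartAt (𝓡 n) (1 : C) with hψ
  set g := ψ.symm x with hg
  have hgs : g ∈ ψ.source := ψ.map_target hx
  have : IsManifold (𝓡 n) 1 C := IsManifold.of_le (n := ∞) (by simp)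
  have a1 := mfderiv_extChartAt_comp_mfderivWithin_extChartAt_symm (I := 𝓡 n) hx
  have a2 := mfderivWithin_extChartAt_symm_comp_mfderiv_extChartAt (I := 𝓡 n) hx
  have hinv : (mfderivWithin 𝓘(ℝ, EuclideanSpace ℝ (Fin n)) (𝓡 n) ψ.symm (range (𝓡 n)) x).inverse =
      mfderiv (𝓡 n) 𝓘(ℝ, EuclideanSpace ℝ (Fin n)) ψ g :=
    ContinuousLinearMap.inverse_eq a2 a1
  have d1 : HasMFDerivAt 𝓘(ℝ, EuclideanSpace ℝ (Fin n)) (𝓡 n) ψ.symm (ψ 1)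
      (mfderiv 𝓘(ℝ, EuclideanSpace ℝ (Fin n)) (𝓡 n) ψ.symm (ψ 1)) :=
    ((contMDiffAt_chart_symm C).mdifferentiableAt (by simp)).hasMFDerivAt
  have d2 : HasMFDerivAt (𝓡 n) (𝓡 n) (fun h => g * h) (ψ.symm (ψ 1))
      (mfderiv (𝓡 n) (𝓡 n) (fun h => g * h) (ψ.symm (ψ 1))) :=
    (((contMDiff_mul_left (I := 𝓡 n) (n := ∞) (a := g)).mdifferentiable (by simp)) _).hasMFDerivAt
  have d3 : HasMFDerivAt (𝓡 n) 𝓘(ℝ, EuclideanSpace ℝ (Fin n)) ψ (g * ψ.symm (ψ 1))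
      (mfderiv (𝓡 n) 𝓘(ℝ, EuclideanSpace ℝ (Fin n)) ψ (g * ψ.symm (ψ 1))) := by
    refine (mdifferentiableAt_extChartAt ?_).hasMFDerivAt
    simpa [hψ] using hgs
  -- Stated for maps of the model space, so that tangent spaces of `C` at different base points do
  -- not have to be identified.
  have aux : ∀ (A B D : EuclideanSpace ℝ (Fin n) →L[ℝ] EuclideanSpace ℝ (Fin n))
      (f : EuclideanSpace ℝ (Fin n) → EuclideanSpace ℝ (Fin n)) (z v : EuclideanSpace ℝ (Fin n)),
      HasFDerivAt f (A.comp (B.comp D)) z → A (B (D v)) = fderiv ℝ f z v := by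
    intro A B D f z v h
    rw [h.fderiv]; rfl
  have d4 := aux _ _ _ (fun y => chartMul C (x, y)) (ψ 1) X
    (hasMFDerivAt_iff_hasFDerivAt.1 (d3.comp (ψ 1) (d2.comp (ψ 1) d1)))
  have e1 : ψ.symm (ψ 1) = 1 := by simp [hψ]
  have d5 : mfderiv 𝓘(ℝ, EuclideanSpace ℝ (Fin n)) (𝓡 n) ψ.symm (ψ 1) =
      ContinuousLinearMap.id ℝ _ := by
    have := mfderivWithin_range_extChartAt_symm (I := 𝓡 n) (x := (1 : C))
    rwa [ModelWithCorners.range_eq_univ, mfderivWithin_univ] at this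
  refine Eq.trans ?_ d4
  change (mfderivWithin 𝓘(ℝ, EuclideanSpace ℝ (Fin n)) (𝓡 n) ψ.symm (range (𝓡 n)) x).inverse _ = _
  rw [hinv, d5]
  rw [e1, mul_one]
  rfl

theorem bracket_eq_chart (X Y : GroupLieAlgebra (𝓡 n) C) :
    (⁅X, Y⁆ : GroupLieAlgebra (𝓡 n) C) =
    fderiv ℝ (fun x => fderiv ℝ (fun y => chartMul C (x, y)) (extChartAt (𝓡 n) (1 : C) 1) Y)
      (extChartAt (𝓡 n) (1 : C) 1) X -
    fderiv ℝ (fun x => fderiv ℝ (fun y => chartMul C (x, y)) (extChartAt (𝓡 n) (1 : C) 1) X)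
      (extChartAt (𝓡 n) (1 : C) 1) Y := by
  rw [GroupLieAlgebra.bracket_def, ← VectorField.mlieBracketWithin_univ,
    VectorField.mlieBracketWithin_apply, mfderiv_extChartAt_self]
  change (ContinuousLinearMap.id ℝ (EuclideanSpace ℝ (Fin n))).inverse _ = _
  rw [ContinuousLinearMap.inverse_id, ContinuousLinearMap.id_apply]
  have hX := mpullbackWithin_eq_fderiv_chartMul C X
  have hY := mpullbackWithin_eq_fderiv_chartMul C Y
  simp only [preimage_univ, ModelWithCorners.range_eq_univ, univ_inter] at hX hY ⊢
  generalize hVX : VectorField.mpullbackWithin 𝓘(ℝ, EuclideanSpace ℝ (Fin n)) (𝓡 n)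
      (extChartAt (𝓡 n) (1 : C)).symm (mulInvariantVectorField X) univ = VX at hX ⊢
  generalize hVY : VectorField.mpullbackWithin 𝓘(ℝ, EuclideanSpace ℝ (Fin n)) (𝓡 n)
      (extChartAt (𝓡 n) (1 : C)).symm (mulInvariantVectorField Y) univ = VY at hY ⊢
  clear hVX hVY
  change EuclideanSpace ℝ (Fin n) → EuclideanSpace ℝ (Fin n) at VX VY
  rw [VectorField.lieBracketWithin_univ]
  have hself : ∀ Z : GroupLieAlgebra (𝓡 n) C,
      fderiv ℝ (fun y => chartMul C (extChartAt (𝓡 n) (1 : C) 1, y))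
        (extChartAt (𝓡 n) (1 : C) 1) Z = Z := by
    intro Z
    have : (fun y => chartMul C (extChartAt (𝓡 n) (1 : C) 1, y)) =ᶠ[𝓝 (extChartAt (𝓡 n) (1 : C) 1)]
        id := by
      filter_upwards [extChartAt_target_mem_nhds (I := 𝓡 n) (1 : C)] with y hy
      simp only [chartMul, extChartAt_to_inv, one_mul, id]
      exact (extChartAt (𝓡 n) (1 : C)).right_inv hy
    rw [this.fderiv_eq, fderiv_id]; rfl
  rw [VectorField.lieBracket_eq]
  have h1 := hX.self_of_nhds
  have h2 := hY.self_of_nhds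
  rw [hself] at h1 h2
  change fderiv ℝ _ _ _ - fderiv ℝ _ _ _ = _
  rw [h1, h2]
  congr 1
  · exact DFunLike.congr_fun (Filter.EventuallyEq.fderiv_eq (𝕜 := ℝ) hY) X
  · exact DFunLike.congr_fun (Filter.EventuallyEq.fderiv_eq (𝕜 := ℝ) hX) Y
end Chart

/-! ### Tangent directions of a subgroup -/

section Family
variable {n : ℕ} {C : Type*} [Group C] [TopologicalSpace C]
  [ChartedSpace (EuclideanSpace ℝ (Fin n)) C]

/-- `W` is the range of the differential at `0` of a map `F` from a Banach space into `C`, with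
values in the subgroup `L`, that sends `0` to the identity, is continuous at `0`, and is strictly
differentiable there in the preferred chart at the identity. Continuity of `F` is required
separately because the chart takes junk values off its source. -/
def IsTangentRange (L : Subgroup C) (W : Submodule ℝ (EuclideanSpace ℝ (Fin n))) : Prop :=
  ∃ (P : Type) (_ : NormedAddCommGroup P) (_ : NormedSpace ℝ P) (_ : CompleteSpace P)
    (F : P → C) (F' : P →L[ℝ] EuclideanSpace ℝ (Fin n)),
    F 0 = 1 ∧ (∀ x, F x ∈ L) ∧ ContinuousAt F 0 ∧
    HasStrictFDerivAt (fun x => extChartAt (𝓡 n) (1 : C) (F x)) F' 0 ∧ F'.range = W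

theorem IsTangentRange.bot (L : Subgroup C) :
    IsTangentRange L (⊥ : Submodule ℝ (EuclideanSpace ℝ (Fin n))) := by
  refine ⟨ℝ, inferInstance, inferInstance, inferInstance, fun _ => 1, 0, rfl,
    fun _ => L.one_mem, continuousAt_const, hasStrictFDerivAt_const _ _, ?_⟩
  ext x; simp

/-- By the open mapping property of strictly differentiable maps with surjective differential. -/
theorem subgroup_mem_nhds_of_isTangentRange_top {L : Subgroup C}
    (h : IsTangentRange L (⊤ : Submodule ℝ (EuclideanSpace ℝ (Fin n)))) : (L : Set C) ∈ 𝓝 1 := by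
  obtain ⟨P, _, _, _, F, F', h0, hL, hc, hd, hs⟩ := h
  have h1 := hd.map_nhds_eq_of_surj hs
  rw [h0] at h1
  have s1 := hc.eventually_mem (by rw [h0]; exact extChartAt_source_mem_nhds (I := 𝓡 n) (1 : C))
  have h2 : (extChartAt (𝓡 n) (1 : C)).symm ⁻¹' (L : Set C) ∈ 𝓝 (extChartAt (𝓡 n) (1 : C) 1) := by
    rw [← h1, mem_map]
    filter_upwards [s1] with x hx
    simp only [mem_preimage]
    rw [(extChartAt (𝓡 n) (1 : C)).left_inv hx]
    exact hL x
  have h3 := (continuousAt_extChartAt (I := 𝓡 n) (1 : C)).preimage_mem_nhds h2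
  filter_upwards [h3, extChartAt_source_mem_nhds (I := 𝓡 n) (1 : C)] with g hg hg'
  simp only [mem_preimage] at hg
  rwa [(extChartAt (𝓡 n) (1 : C)).left_inv hg'] at hg

variable [LieGroup (𝓡 n) ∞ C]

theorem chartMul_hasStrictFDerivAt : HasStrictFDerivAt (chartMul C (n := n))
    (ContinuousLinearMap.fst ℝ _ _ + ContinuousLinearMap.snd ℝ _ _)
    (extChartAt (𝓡 n) (1 : C) 1, extChartAt (𝓡 n) (1 : C) 1) := by
  have h := contDiffAt_chartMul (n := n) C
  have hd := h.differentiableAt (by simp)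
  have h1 := h.hasStrictFDerivAt (by simp)
  convert! h1 using 1
  have hr : (fun y => chartMul C (extChartAt (𝓡 n) (1 : C) 1, y)) =ᶠ[𝓝 (extChartAt (𝓡 n) (1 : C) 1)]
      id := by
    filter_upwards [extChartAt_target_mem_nhds (I := 𝓡 n) (1 : C)] with y hy
    simp only [chartMul, extChartAt_to_inv, one_mul, id]
    exact (extChartAt (𝓡 n) (1 : C)).right_inv hy
  have hl : (fun y => chartMul C (y, extChartAt (𝓡 n) (1 : C) 1)) =ᶠ[𝓝 (extChartAt (𝓡 n) (1 : C) 1)]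
      id := by
    filter_upwards [extChartAt_target_mem_nhds (I := 𝓡 n) (1 : C)] with y hy
    simp only [chartMul, extChartAt_to_inv, mul_one, id]
    exact (extChartAt (𝓡 n) (1 : C)).right_inv hy
  have hr' := hr.fderiv_eq (𝕜 := ℝ)
  have hl' := hl.fderiv_eq (𝕜 := ℝ)
  rw [fderiv_right_eq hd, fderiv_id] at hr'
  rw [fderiv_left_eq hd, fderiv_id] at hl'
  ext1
  · rw [hl']; ext; simp
  · rw [hr']; ext; simp

/-- The pointwise product of two maps into `L` realizes the sum of the two ranges. -/
theorem IsTangentRange.sup {L : Subgroup C} {W₁ W₂ : Submodule ℝ (EuclideanSpace ℝ (Fin n))}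
    (h₁ : IsTangentRange L W₁) (h₂ : IsTangentRange L W₂) : IsTangentRange L (W₁ ⊔ W₂) := by
  obtain ⟨P₁, _, _, _, F₁, F₁', h01, hL1, hc1, hd1, rfl⟩ := h₁
  obtain ⟨P₂, _, _, _, F₂, F₂', h02, hL2, hc2, hd2, rfl⟩ := h₂
  have : IsTopologicalGroup C := topologicalGroup_of_lieGroup (𝓡 n) ∞
  have hc1' : ContinuousAt (fun x : P₁ × P₂ => F₁ x.1) 0 :=
    ContinuousAt.comp (f := Prod.fst) (x := (0 : P₁ × P₂)) hc1 continuousAt_fst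
  have hc2' : ContinuousAt (fun x : P₁ × P₂ => F₂ x.2) 0 :=
    ContinuousAt.comp (f := Prod.snd) (x := (0 : P₁ × P₂)) hc2 continuousAt_snd
  refine ⟨P₁ × P₂, inferInstance, inferInstance, inferInstance, fun x => F₁ x.1 * F₂ x.2,
    F₁'.coprod F₂', by simp [h01, h02], fun x => L.mul_mem (hL1 _) (hL2 _),
    hc1'.mul hc2', ?_, ?_⟩
  · have e1 : HasStrictFDerivAt (fun x : P₁ × P₂ => extChartAt (𝓡 n) (1 : C) (F₁ x.1))
        (F₁'.comp (ContinuousLinearMap.fst ℝ P₁ P₂)) 0 :=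
      HasStrictFDerivAt.comp (f := Prod.fst) (0 : P₁ × P₂) hd1 hasStrictFDerivAt_fst
    have e2 : HasStrictFDerivAt (fun x : P₁ × P₂ => extChartAt (𝓡 n) (1 : C) (F₂ x.2))
        (F₂'.comp (ContinuousLinearMap.snd ℝ P₁ P₂)) 0 :=
      HasStrictFDerivAt.comp (f := Prod.snd) (0 : P₁ × P₂) hd2 hasStrictFDerivAt_snd
    have e3 := chartMul_hasStrictFDerivAt (n := n) (C := C)
    have e4 : (extChartAt (𝓡 n) (1 : C) 1, extChartAt (𝓡 n) (1 : C) 1) =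
      (fun x : P₁ × P₂ => (extChartAt (𝓡 n) (1 : C) (F₁ x.1),
        extChartAt (𝓡 n) (1 : C) (F₂ x.2))) 0 := by simp [h01, h02]
    rw [e4] at e3
    have e5 := e3.comp (0 : P₁ × P₂) (e1.prodMk e2)
    have e6 := e5.congr_of_eventuallyEq (f₁ := fun x : P₁ × P₂ =>
      extChartAt (𝓡 n) (1 : C) (F₁ x.1 * F₂ x.2)) ?_
    · convert! e6 using 1
    · have s1 := hc1'.eventually_mem (by
        simp only [Prod.fst_zero, h01]; exact extChartAt_source_mem_nhds (I := 𝓡 n) (1 : C))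
      have s2 := hc2'.eventually_mem (by
        simp only [Prod.snd_zero, h02]; exact extChartAt_source_mem_nhds (I := 𝓡 n) (1 : C))
      filter_upwards [s1, s2] with x h1 h2
      simp only [chartMul]
      rw [(extChartAt (𝓡 n) (1 : C)).left_inv h1, (extChartAt (𝓡 n) (1 : C)).left_inv h2]
  · exact LinearMap.range_coprod _ _

/-- Conjugating a map into `L` by an element of `L` moves its range by the differential of the
conjugation. -/
theorem IsTangentRange.conj {L : Subgroup C} {W : Submodule ℝ (EuclideanSpace ℝ (Fin n))}
    (h : IsTangentRange L W) {g : C} (hg : g ∈ L) :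
    IsTangentRange L
      (W.map (fderiv ℝ (chartConj C (n := n) g) (extChartAt (𝓡 n) (1 : C) 1)).toLinearMap) := by
  obtain ⟨P, _, _, _, F, F', h0, hL, hc, hd, rfl⟩ := h
  have : IsTopologicalGroup C := topologicalGroup_of_lieGroup (𝓡 n) ∞
  refine ⟨P, inferInstance, inferInstance, inferInstance, fun x => g⁻¹ * F x * g,
    (fderiv ℝ (chartConj C (n := n) g) (extChartAt (𝓡 n) (1 : C) 1)).comp F', by simp [h0],
    fun x => L.mul_mem (L.mul_mem (L.inv_mem hg) (hL x)) hg,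
    (continuousAt_const.mul hc).mul continuousAt_const, ?_, LinearMap.range_comp _ _⟩
  have e3 := (contDiffAt_chartConj (n := n) C g).hasStrictFDerivAt (by simp)
  have e4 : HasStrictFDerivAt (chartConj C (n := n) g) (fderiv ℝ (chartConj C (n := n) g)
    (extChartAt (𝓡 n) (1 : C) 1)) (extChartAt (𝓡 n) (1 : C) (F 0)) := by rw [h0]; exact e3
  refine (e4.comp (0 : P) hd).congr_of_eventuallyEq ?_
  have s1 := hc.eventually_mem (by rw [h0]; exact extChartAt_source_mem_nhds (I := 𝓡 n) (1 : C))
  filter_upwards [s1] with x h1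
  simp only [chartConj]
  rw [(extChartAt (𝓡 n) (1 : C)).left_inv h1]

theorem hasDerivAt_chart_oneParameter {γ : ℝ → C} {X : GroupLieAlgebra (𝓡 n) C} (h0 : γ 0 = 1)
    (hγ : IsMIntegralCurve (I := 𝓡 n) γ (mulInvariantVectorField X)) :
    HasDerivAt (fun t => extChartAt (𝓡 n) (1 : C) (γ t)) (X : EuclideanSpace ℝ (Fin n)) 0 := by
  have h1 := hγ 0
  have h2 : HasMFDerivAt (𝓡 n) 𝓘(ℝ, EuclideanSpace ℝ (Fin n)) (extChartAt (𝓡 n) (1 : C)) (γ 0)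
      (mfderiv (𝓡 n) 𝓘(ℝ, EuclideanSpace ℝ (Fin n)) (extChartAt (𝓡 n) (1 : C)) (γ 0)) :=
    (mdifferentiableAt_extChartAt (by rw [h0]; exact mem_chart_source _ _)).hasMFDerivAt
  have h3 := hasMFDerivAt_iff_hasFDerivAt.1 (h2.comp 0 h1)
  have h4 : ∀ (f : ℝ → EuclideanSpace ℝ (Fin n)) (A : ℝ →L[ℝ] EuclideanSpace ℝ (Fin n)),
      HasFDerivAt f A 0 → A 1 = X → HasDerivAt f (X : EuclideanSpace ℝ (Fin n)) 0 := by
    intro f A hf hA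
    have := hf.hasDerivAt
    rwa [hA] at this
  refine h4 _ _ h3 ?_
  rw [h0]
  rw [mfderiv_extChartAt_self]
  change (1 : ℝ) • mulInvariantVectorField X (1 : C) = X
  rw [one_smul]
  have hid : (fun x : C => 1 * x) = id := funext one_mul
  refine (congrArg (fun f : C → C => (mfderiv (𝓡 n) (𝓡 n) f (1 : C) :
    EuclideanSpace ℝ (Fin n) →L[ℝ] EuclideanSpace ℝ (Fin n)) X) hid).trans ?_
  exact DFunLike.congr_fun (mfderiv_id (I := 𝓡 n) (x := (1 : C))) X

/-- The relation `γ (t + s) = γ t * γ s` expresses the derivative of `γ` at `t` through its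
derivative at `0`, continuously in `t`; therefore the derivative at `0` is strict. -/
theorem hasStrictDerivAt_chart_oneParameter {γ : ℝ → C} {X : GroupLieAlgebra (𝓡 n) C}
    (h0 : γ 0 = 1) (hγ : IsMIntegralCurve (I := 𝓡 n) γ (mulInvariantVectorField X))
    (hadd : ∀ s t, γ (s + t) = γ s * γ t) :
    HasStrictDerivAt (fun t => extChartAt (𝓡 n) (1 : C) (γ t))
      (X : EuclideanSpace ℝ (Fin n)) 0 := by
  set ψ := extChartAt (𝓡 n) (1 : C) with hψ
  have hd := hasDerivAt_chart_oneParameter h0 hγ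
  have hcγ : ContinuousAt γ 0 := (hγ 0).continuousAt
  have hc : ContinuousAt (fun t => ψ (γ t)) 0 := hd.continuousAt
  have hm2 : ContDiffAt ℝ 2 (chartMul C (n := n)) (ψ 1, ψ 1) :=
    (contDiffAt_chartMul (n := n) C).of_le (WithTop.coe_le_coe.2 (le_top : (2 : ℕ∞) ≤ ⊤))
  have key : ∀ᶠ t in 𝓝 (0 : ℝ), HasDerivAt (fun t => ψ (γ t))
      (fderiv ℝ (fun y => chartMul C (ψ (γ t), y)) (ψ 1) X) t := by
    have s1 : ∀ᶠ t in 𝓝 (0 : ℝ), γ t ∈ ψ.source := hcγ.eventually_mem (by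
      rw [h0]; exact extChartAt_source_mem_nhds (I := 𝓡 n) (1 : C))
    have s2 : ∀ᶠ t in 𝓝 (0 : ℝ), DifferentiableAt ℝ (chartMul C (n := n)) (ψ (γ t), ψ 1) := by
      refine Tendsto.eventually (f := fun t => (ψ (γ t), ψ 1)) ?_ (eventually_differentiableAt hm2)
      have : ContinuousAt (fun t => (ψ (γ t), ψ 1)) 0 := hc.prodMk continuousAt_const
      have h := this.tendsto
      rwa [h0] at h
    filter_upwards [s1, s2] with t ht1 ht2
    have e1 : DifferentiableAt ℝ (fun y => chartMul C (ψ (γ t), y)) (ψ (γ 0)) := by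
      rw [h0]
      exact DifferentiableAt.comp (f := fun y => (ψ (γ t), y)) (ψ 1) ht2
        (hasFDerivAt_prodMk_right (𝕜 := ℝ) _ _).differentiableAt
    have e2 := HasFDerivAt.comp_hasDerivAt (0 : ℝ) e1.hasFDerivAt hd
    rw [h0] at e2
    have e3 : (fun s => ψ (γ (t + s))) =ᶠ[𝓝 0]
        ((fun y => chartMul C (ψ (γ t), y)) ∘ fun s => ψ (γ s)) := by
      filter_upwards [s1] with s hs
      simp only [Function.comp, chartMul]
      rw [← hψ, ψ.left_inv hs, ψ.left_inv ht1, hadd]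
    have e4 := e2.congr_of_eventuallyEq e3
    have e5 : HasDerivAt (fun s => ψ (γ (t + s)))
      (fderiv ℝ (fun y => chartMul C (ψ (γ t), y)) (ψ 1) X) (t - t) := by rw [sub_self]; exact e4
    have e6 := e5.comp_sub_const t t
    simpa using e6
  have hcd : ContinuousAt (fun t => fderiv ℝ (fun y => chartMul C (ψ (γ t), y)) (ψ 1) X) 0 := by
    have := (hasFDerivAt_fderiv_right hm2 X).continuousAt
    have h' : ContinuousAt (fun x => fderiv ℝ (fun y => chartMul C (x, y)) (ψ 1) X) (ψ (γ 0)) := by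
      rw [h0]; exact this
    exact ContinuousAt.comp (f := fun t => ψ (γ t)) h' hc
  have := hasStrictDerivAt_of_hasDerivAt_of_continuousAt key hcd
  have e := key.self_of_nhds.unique hd
  rwa [e] at this

theorem IsTangentRange.span_of_oneParameter {L : Subgroup C} {γ : ℝ → C}
    {X : GroupLieAlgebra (𝓡 n) C} (hL : ∀ t, γ t ∈ L)
    (h0 : γ 0 = 1) (hγ : IsMIntegralCurve (I := 𝓡 n) γ (mulInvariantVectorField X))
    (hadd : ∀ s t, γ (s + t) = γ s * γ t) :
    IsTangentRange L (Submodule.span ℝ {(X : EuclideanSpace ℝ (Fin n))}) := by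
  have hr : ∀ x : EuclideanSpace ℝ (Fin n),
      (ContinuousLinearMap.toSpanSingleton ℝ x).range = Submodule.span ℝ {x} := by
    intro x
    ext v
    simp [Submodule.mem_span_singleton]
  exact ⟨ℝ, inferInstance, inferInstance, inferInstance, γ, _, h0, hL, (hγ 0).continuousAt,
    (hasStrictDerivAt_chart_oneParameter h0 hγ hadd).hasStrictFDerivAt, hr _⟩

theorem bracket_mem_of_invariant {W : Submodule ℝ (EuclideanSpace ℝ (Fin n))} {γ : ℝ → C}
    {X Y : GroupLieAlgebra (𝓡 n) C} (h0 : γ 0 = 1)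
    (hγ : IsMIntegralCurve (I := 𝓡 n) γ (mulInvariantVectorField X))
    (hW : ∀ t, fderiv ℝ (chartConj C (n := n) (γ t)) (extChartAt (𝓡 n) (1 : C) 1) Y ∈ W) :
    (⁅X, Y⁆ : GroupLieAlgebra (𝓡 n) C) ∈ W := by
  set ψ := extChartAt (𝓡 n) (1 : C) with hψ
  have : IsTopologicalGroup C := topologicalGroup_of_lieGroup (𝓡 n) ∞
  rw [bracket_eq_chart]
  have h2 : (2 : WithTop ℕ∞) ≤ ∞ := WithTop.coe_le_coe.2 (le_top : (2 : ℕ∞) ≤ ⊤)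
  have ht : ψ.target ∈ 𝓝 (ψ 1) := extChartAt_target_mem_nhds (I := 𝓡 n) (1 : C)
  have hs : ψ.source ∈ 𝓝 (1 : C) := extChartAt_source_mem_nhds (I := 𝓡 n) (1 : C)
  have e1 : ψ.symm (ψ 1) = 1 := by simp [hψ]
  have hsymm : ContinuousAt ψ.symm (ψ 1) := (contMDiffAt_chart_symm (n := n) C).continuousAt
  refine chartBracket_mem_of_conj_mem (m := chartMul C) (c := fun p => chartConj C (ψ.symm p.1) p.2)
    (γ := fun t => ψ (γ t))
    ((contDiffAt_chartMul (n := n) C).of_le h2) ((contDiffAt_chartConj_prod (n := n) C).of_le h2)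
    ?_ ?_ ?_ ?_ (by rw [h0]) (hasDerivAt_chart_oneParameter h0 hγ) W ?_
  · filter_upwards [ht] with y hy
    simp only [chartMul]
    rw [← hψ, e1, one_mul, ψ.right_inv hy]
  · refine Eventually.of_forall fun x => ?_
    simp only [chartConj]
    rw [← hψ, e1]; simp
  · filter_upwards [ht] with y hy
    simp only [chartConj]
    rw [← hψ, e1]
    simp only [inv_one, one_mul, mul_one]
    exact ψ.right_inv hy
  · have c1 : ContinuousAt (fun p : EuclideanSpace ℝ (Fin n) × EuclideanSpace ℝ (Fin n) =>
        (ψ.symm p.1)⁻¹ * ψ.symm p.2 * ψ.symm p.1) (ψ 1, ψ 1) := by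
      have a1 : ContinuousAt (fun p : EuclideanSpace ℝ (Fin n) × EuclideanSpace ℝ (Fin n) =>
        ψ.symm p.1) (ψ 1, ψ 1) := ContinuousAt.comp (f := Prod.fst) hsymm continuousAt_fst
      have a2 : ContinuousAt (fun p : EuclideanSpace ℝ (Fin n) × EuclideanSpace ℝ (Fin n) =>
        ψ.symm p.2) (ψ 1, ψ 1) := ContinuousAt.comp (f := Prod.snd) hsymm continuousAt_snd
      exact (a1.inv.mul a2).mul a1
    have c2 := c1.eventually_mem (s := ψ.source) (by simpa [e1] using hs)
    filter_upwards [c2] with p hp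
    simp only [chartMul, chartConj]
    rw [← hψ, ψ.left_inv hp]
    group
  · have c1 : ContinuousAt γ 0 := (hγ 0).continuousAt
    filter_upwards [c1.eventually_mem (by rw [h0]; exact hs)] with t ht
    change fderiv ℝ (chartConj C (ψ.symm (ψ (γ t)))) (ψ 1) Y ∈ W
    rw [ψ.left_inv ht]
    exact hW t

/-- A subgroup of a connected Lie group that contains the one-parameter subgroups tangent to the
first layer of a stratification is the whole group. -/
theorem subgroup_eq_top_of_oneParameter [ConnectedSpace C] {L : Subgroup C}
    {V : ℕ → Submodule ℝ (GroupLieAlgebra (𝓡 n) C)} (hV : IsStratification n C V)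
    (h : ∀ X ∈ V 0, ∃ γ : ℝ → C, (∀ t, γ t ∈ L) ∧ γ 0 = 1 ∧ (∀ s t, γ (s + t) = γ s * γ t) ∧
      IsMIntegralCurve (I := 𝓡 n) γ (mulInvariantVectorField X)) : L = ⊤ := by
  have : IsTopologicalGroup C := topologicalGroup_of_lieGroup (𝓡 n) ∞
  -- Since ranges can be added, a maximal one contains all others; in particular it is invariant
  -- under conjugation by `L`.
  obtain ⟨W, hW, hmax⟩ := WellFounded.has_min
    (r := fun W₁ W₂ : Submodule ℝ (EuclideanSpace ℝ (Fin n)) => W₁ > W₂)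
    wellFounded_gt {W | IsTangentRange L W} ⟨⊥, IsTangentRange.bot L⟩
  have hle : ∀ W', IsTangentRange L W' → W' ≤ W := by
    intro W' hW'
    by_contra hcon
    exact hmax _ (hW.sup hW')
      (lt_of_le_of_ne le_sup_left fun h => hcon (by rw [h]; exact le_sup_right))
  have hVW : ∀ k, ∀ X ∈ V k, (X : EuclideanSpace ℝ (Fin n)) ∈ W := by
    intro k
    induction k with
    | zero =>
      intro X hX
      obtain ⟨γ, hL, h0, hadd, hγ⟩ := h X hX
      exact hle _ (IsTangentRange.span_of_oneParameter hL h0 hγ hadd)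
        (Submodule.mem_span_singleton_self _)
    | succ k ih =>
      intro X hX
      rw [← hV.span_bracket k] at hX
      refine (Submodule.span_le (p := (W : Submodule ℝ (GroupLieAlgebra (𝓡 n) C)))).2 ?_ hX
      rintro _ ⟨X, hX, Y, hY, rfl⟩
      obtain ⟨γ, hL, h0, hadd, hγ⟩ := h X hX
      refine bracket_mem_of_invariant (W := W) h0 hγ fun t => ?_
      exact hle _ (hW.conj (hL t)) (Submodule.mem_map_of_mem (ih Y hY))
  have hWtop : W = ⊤ := by
    have h1 := hV.isInternal.submodule_iSup_eq_top
    have h2 : (⊤ : Submodule ℝ (GroupLieAlgebra (𝓡 n) C)) ≤ W := by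
      rw [← h1]
      exact iSup_le fun k X hX => hVW k X hX
    exact top_le_iff.1 h2
  rw [hWtop] at hW
  have hopen := L.isOpen_of_mem_nhds (subgroup_mem_nhds_of_isTangentRange_top hW)
  have hclosed := Subgroup.isClosed_of_isOpen L hopen
  have := IsClopen.eq_univ ⟨hclosed, hopen⟩ ⟨1, L.one_mem⟩
  exact SetLike.coe_injective (by simpa using this)

end Family

/-! ### Carnot groups are generated by horizontal elements -/

/-- An element `u` is horizontal if `t ↦ δ_t u` is a one-parameter subgroup. -/
def IsHorizontal {G : Type*} [Group G] [TopologicalSpace G] [IsTopologicalGroup G]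
    [ScalableGroup G] (u : G) : Prop :=
  ∀ s t : ℝ, ScalableGroup.dil (s + t) u = ScalableGroup.dil s u * ScalableGroup.dil t u

namespace HasCarnotGroupStructure
variable {N : Type*} [Group N] [TopologicalSpace N] [IsTopologicalGroup N] [ScalableGroup N]

theorem locallyCompactSpace (h : HasCarnotGroupStructure N) : LocallyCompactSpace N := by
  obtain ⟨n, C, _, _, _, _, _, V, ζ, φ, -⟩ := h
  have : LocallyCompactSpace C := Manifold.locallyCompact_of_finiteDimensional (𝓡 n)
  exact φ.toHomeomorph.isClosedEmbedding.locallyCompactSpace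

/-- A Carnot group is generated by its horizontal elements: the one-parameter subgroups tangent to
the first layer consist of horizontal elements, since the dilation of factor `t` multiplies that
layer by `t`. -/
theorem closure_isHorizontal [T2Space N] (h : HasCarnotGroupStructure N) :
    Subgroup.closure {u : N | IsHorizontal u} = ⊤ := by
  obtain ⟨n, C, _, _, _, _, _, V, ζ, φ, hV, hζ, hφ⟩ := h
  have : T2Space C := φ.toHomeomorph.symm.isEmbedding.t2Space
  have key : (Subgroup.closure {u : N | IsHorizontal u}).map φ.toMulEquiv.toMonoidHom = ⊤ := by
    refine subgroup_eq_top_of_oneParameter hV fun X hX => ?_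
    obtain ⟨γ, h0, hγ, hadd, hdil⟩ := exists_oneParameterSubgroup X
    refine ⟨γ, fun t => ?_, h0, hadd, hγ⟩
    have hd : ∀ s, ScalableGroup.dil s (φ.symm (γ t)) = φ.symm (γ (s * t)) := by
      intro s
      apply φ.injective
      have e := (hζ s).mfderiv_eq 0 X hX
      rw [zero_add, pow_one] at e
      rw [hφ, φ.apply_symm_apply, φ.apply_symm_apply, hdil s (ζ s) (hζ s).contMDiff e]
    refine ⟨φ.symm (γ t), Subgroup.subset_closure fun r s => ?_, φ.apply_symm_apply _⟩
    rw [hd, hd, hd, add_mul, hadd, map_mul]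
  rw [eq_top_iff]
  intro x _
  have hx : φ x ∈ (Subgroup.closure {u : N | IsHorizontal u}).map φ.toMulEquiv.toMonoidHom := by
    rw [key]; trivial
  obtain ⟨y, hy, hyx⟩ := hx
  rwa [← φ.injective hyx]

end HasCarnotGroupStructure

/-! ### Dilations and Haar measure -/

namespace ScalableGroup
section
variable {N : Type*} [Group N] [TopologicalSpace N] [IsTopologicalGroup N] [ScalableGroup N]

theorem dil_one (x : N) : dil 1 x = x :=
  (bijective_dil (G := N) 1 one_ne_zero).1 (by rw [dil_dil, mul_one])

theorem dil_map_one (t : ℝ) : dil t (1 : N) = 1 := by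
  rcases eq_or_ne t 0 with rfl | ht
  · exact dil_zero 1
  · have := dil_mul t ht (1 : N) 1
    rwa [mul_one, left_eq_mul] at this

theorem dil_map_mul (t : ℝ) (x y : N) : dil t (x * y) = dil t x * dil t y := by
  rcases eq_or_ne t 0 with rfl | ht
  · simp only [dil_zero, mul_one]
  · exact dil_mul t ht x y

theorem continuous_dil_const (t : ℝ) : Continuous (dil t : N → N) :=
  continuous_dil.comp (continuous_const.prodMk continuous_id)

theorem continuous_dil_left (x : N) : Continuous fun t : ℝ => dil t x :=
  continuous_dil.comp (continuous_id.prodMk continuous_const)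

theorem dil_inv_dil {t : ℝ} (ht : t ≠ 0) (x : N) : dil t⁻¹ (dil t x) = x := by
  rw [dil_dil, inv_mul_cancel₀ ht, dil_one]

theorem dil_dil_inv {t : ℝ} (ht : t ≠ 0) (x : N) : dil t (dil t⁻¹ x) = x := by
  rw [dil_dil, mul_inv_cancel₀ ht, dil_one]

/-- The dilation of nonzero factor `t` as an automorphism of topological groups. -/
noncomputable def dilEquiv {t : ℝ} (ht : t ≠ 0) : N ≃ₜ* N where
  toFun := dil t
  invFun := dil t⁻¹
  left_inv := dil_inv_dil ht
  right_inv := dil_dil_inv ht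
  map_mul' := dil_map_mul t
  continuous_toFun := continuous_dil_const t
  continuous_invFun := continuous_dil_const t⁻¹

variable (N) in
/-- The dilates of a compact neighbourhood of the identity exhaust the group. -/
theorem sigmaCompactSpace [LocallyCompactSpace N] : SigmaCompactSpace N := by
  obtain ⟨K, hK, hK1⟩ := exists_compact_mem_nhds (1 : N)
  refine ⟨⟨fun k : ℕ => dil (k : ℝ) '' K, fun k => hK.image (continuous_dil_const _), ?_⟩⟩
  refine eq_univ_of_forall fun x => mem_iUnion.2 ?_
  have h1 : Tendsto (fun k : ℕ => dil ((k : ℝ)⁻¹) x) atTop (𝓝 1) := by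
    have := ((continuous_dil_left x).tendsto 0).comp (tendsto_inv_atTop_nhds_zero_nat (𝕜 := ℝ))
    rwa [dil_zero] at this
  obtain ⟨k, hk, hk0⟩ := ((h1.eventually_mem hK1).and (eventually_gt_atTop 0)).exists
  exact ⟨k, _, hk, dil_dil_inv (by positivity) x⟩

end

section Metric

theorem secondCountableTopology (N : Type*) [Group N] [MetricSpace N] [IsTopologicalGroup N]
    [ScalableGroup N] [LocallyCompactSpace N] : SecondCountableTopology N :=
  have := sigmaCompactSpace N
  EMetric.secondCountable_of_sigmaCompact N

variable {N : Type*} [Group N] [MetricSpace N] [IsTopologicalGroup N] [ScalableGroup N]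
  [MetricScalableGroup N]

theorem dist_dil_one (t : ℝ) (u : N) : dist (dil t u) 1 = |t| * dist u 1 := by
  rw [← MetricScalableGroup.dist_dil, dil_map_one]

theorem dist_mul_left_self (p x : N) : dist (p * x) p = dist x 1 := by
  conv_lhs => rw [← mul_one p, mul_assoc, one_mul]
  exact MetricScalableGroup.dist_mul_left p x 1

/-- Haar measures are doubling: `δ_2` maps the ball of radius `r` onto the one of radius `2 r` and
multiplies the measure by a constant. -/
theorem isUnifLocDoublingMeasure [LocallyCompactSpace N] [MeasurableSpace N] [BorelSpace N]
    (μ : Measure N) [μ.IsHaarMeasure] : IsUnifLocDoublingMeasure μ := by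
  have := sigmaCompactSpace N
  have := secondCountableTopology N
  refine ⟨mulEquivHaarChar (dilEquiv (N := N) two_ne_zero), Eventually.of_forall fun ε x => ?_⟩
  have hball : ∀ r, μ (Metric.closedBall x r) = μ (Metric.closedBall 1 r) := by
    intro r
    rw [← measure_preimage_mul μ x (Metric.closedBall x r)]
    congr 1
    ext y
    simp [dist_mul_left_self]
  rw [hball, hball, ← mulEquivHaarChar_smul_preimage μ (dilEquiv (N := N) two_ne_zero)]
  have : (dilEquiv (N := N) two_ne_zero) ⁻¹' Metric.closedBall 1 (2 * ε) =
      Metric.closedBall 1 ε := by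
    ext y
    change dist (dil 2 y) 1 ≤ _ ↔ _
    rw [dist_dil_one]
    simp
  rw [this]
  rfl
end Metric
end ScalableGroup

open ScalableGroup

/-! ### Almost everywhere differentiability of Lipschitz functions -/

section Diff
variable {N : Type*} [Group N] [MetricSpace N] [IsTopologicalGroup N] [ScalableGroup N]

/-- The difference quotient of `f` at `p` in the direction `u`, with junk value `0` at `t = 0`. -/
noncomputable def diffQuot (f : N → ℝ) (p u : N) (t : ℝ) : ℝ :=
  t⁻¹ * (f (p * dil t u) - f p)

/-- `f` has a derivative at `p` along the curve `t ↦ p * δ_t u`. -/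
def HasDirDeriv (f : N → ℝ) (p u : N) : Prop :=
  ∃ c, Tendsto (diffQuot f p u) (𝓝[≠] 0) (𝓝 c)

/-- At `p` the difference quotients of `f` are asymptotically additive in the directions `u` and
`v`. The derivatives themselves are not required to exist; this makes the condition a limit with a
prescribed value and so visibly measurable in `p`. -/
def IsAdditiveAt (f : N → ℝ) (p u v : N) : Prop :=
  Tendsto (fun t => diffQuot f p (u * v) t - diffQuot f p u t - diffQuot f p v t) (𝓝[≠] 0) (𝓝 0)

theorem IsAdditiveAt.hasDirDeriv_mul {f : N → ℝ} {p u v : N} (h : IsAdditiveAt f p u v)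
    (hu : HasDirDeriv f p u) (hv : HasDirDeriv f p v) : HasDirDeriv f p (u * v) := by
  obtain ⟨a, ha⟩ := hu
  obtain ⟨b, hb⟩ := hv
  refine ⟨0 + a + b, ((h.add ha).add hb).congr fun t => ?_⟩
  ring

theorem hasDirDeriv_one (f : N → ℝ) (p : N) : HasDirDeriv f p 1 := by
  refine ⟨0, tendsto_const_nhds.congr fun t => ?_⟩
  simp [diffQuot, dil_map_one]

theorem IsAdditiveAt.hasDirDeriv_inv {f : N → ℝ} {p u : N} (h : IsAdditiveAt f p u⁻¹ u)
    (hu : HasDirDeriv f p u) : HasDirDeriv f p u⁻¹ := by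
  obtain ⟨a, ha⟩ := hu
  refine ⟨-0 - a, (h.neg.sub ha).congr fun t => ?_⟩
  have : diffQuot f p (u⁻¹ * u) t = 0 := by simp [diffQuot, dil_map_one]
  rw [this]
  ring

/-- Limits at `0` along the punctured line can be tested on rational points; this reduces
measurability of the differentiability sets to countable families. -/
theorem tendsto_punctured_iff_rat {F : ℝ → ℝ} (hF : ContinuousOn F {0}ᶜ) (c : ℝ) :
    Tendsto F (𝓝[≠] 0) (𝓝 c) ↔
      Tendsto (fun q : ℚ => F q) (comap (fun q : ℚ => (q : ℝ)) (𝓝[≠] 0)) (𝓝 c) := by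
  refine ⟨fun h => h.comp tendsto_comap, fun h => ?_⟩
  rw [(closed_nhds_basis c).tendsto_right_iff]
  rintro V ⟨hV, hVc⟩
  obtain ⟨S, hS, hSV⟩ := mem_comap.1 (h hV)
  obtain ⟨U, hU, hU0, hUS⟩ := mem_nhdsWithin.1 hS
  filter_upwards [mem_nhdsWithin.2 ⟨U, hU, hU0, Subset.rfl⟩] with t ht
  have hopen : IsOpen (U ∩ {0}ᶜ : Set ℝ) := hU.inter isOpen_compl_singleton
  have hd := (Rat.denseRange_cast (𝕜 := ℝ)).open_subset_closure_inter hopen ht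
  have hc : ContinuousWithinAt F (U ∩ {0}ᶜ ∩ range ((↑) : ℚ → ℝ)) t :=
    (hF t ht.2).mono fun x hx => hx.1.2
  have := hc.mem_closure hd (t := V) (by
    rintro _ ⟨hx, q, rfl⟩
    exact hSV (show (q : ℝ) ∈ S from hUS hx))
  rwa [hVc.closure_eq] at this

theorem continuousOn_diffQuot {f : N → ℝ} (hf : Continuous f) (p u : N) :
    ContinuousOn (diffQuot f p u) {0}ᶜ := by
  refine ContinuousOn.mul (continuousOn_inv₀.mono fun x hx => hx) (Continuous.continuousOn ?_)
  exact (hf.comp (continuous_const.mul (continuous_dil_left u))).sub continuous_const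

theorem continuous_diffQuot_base {f : N → ℝ} (hf : Continuous f) (u : N) (t : ℝ) :
    Continuous fun p => diffQuot f p u t :=
  continuous_const.mul ((hf.comp (continuous_id.mul continuous_const)).sub hf)

theorem measurableSet_hasDirDeriv [MeasurableSpace N] [BorelSpace N] {f : N → ℝ}
    (hf : Continuous f) (u : N) : MeasurableSet {p | HasDirDeriv f p u} := by
  have : {p | HasDirDeriv f p u} = {p | ∃ c, Tendsto (fun q : ℚ => diffQuot f p u q)
      (comap (fun q : ℚ => (q : ℝ)) (𝓝[≠] 0)) (𝓝 c)} := by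
    ext p
    exact exists_congr fun c => tendsto_punctured_iff_rat (continuousOn_diffQuot hf p u) c
  rw [this]
  exact measurableSet_exists_tendsto fun q => (continuous_diffQuot_base hf u q).measurable

theorem measurableSet_isAdditiveAt [MeasurableSpace N] [BorelSpace N] {f : N → ℝ}
    (hf : Continuous f) (u v : N) : MeasurableSet {p | IsAdditiveAt f p u v} := by
  have : {p | IsAdditiveAt f p u v} = {p | Tendsto (fun q : ℚ =>
      diffQuot f p (u * v) q - diffQuot f p u q - diffQuot f p v q)
      (comap (fun q : ℚ => (q : ℝ)) (𝓝[≠] 0)) (𝓝 0)} := by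
    ext p
    exact tendsto_punctured_iff_rat (((continuousOn_diffQuot hf p _).sub
      (continuousOn_diffQuot hf p u)).sub (continuousOn_diffQuot hf p v)) 0
  rw [this]
  exact measurableSet_tendsto _ fun q => (((continuous_diffQuot_base hf _ q).sub
    (continuous_diffQuot_base hf u q)).sub (continuous_diffQuot_base hf v q)).measurable

variable [MetricScalableGroup N] {K : NNReal} {f : N → ℝ}

theorem lipschitz_along_horizontal (hf : LipschitzWith K f) {u : N} (hu : IsHorizontal u) (p : N) :
    LipschitzWith (K * nndist u 1) fun s : ℝ => f (p * dil s u) := by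
  refine LipschitzWith.of_dist_le_mul fun s t => ?_
  refine (hf.dist_le_mul _ _).trans ?_
  have h : dil s u = dil t u * dil (s - t) u := by rw [← hu]; congr 1; ring
  rw [h, ← mul_assoc, dist_mul_left_self, dist_dil_one, Real.dist_eq]
  apply le_of_eq
  rw [NNReal.coe_mul, coe_nndist]
  ring

variable [LocallyCompactSpace N] [MeasurableSpace N] [BorelSpace N]
  (μ : Measure N) [μ.IsHaarMeasure]

/-- Along the curve `s ↦ p * δ_s u` the function is Lipschitz, so it is differentiable at almost
every `s`. Fubini's theorem yields one `s` for which `p * δ_s u` is good for almost every `p`, and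
right translations preserve null sets. -/
theorem ae_hasDirDeriv_of_isHorizontal (hf : LipschitzWith K f) {u : N} (hu : IsHorizontal u) :
    ∀ᵐ p ∂μ, HasDirDeriv f p u := by
  have := sigmaCompactSpace N
  have := secondCountableTopology N
  have hm := measurableSet_hasDirDeriv hf.continuous u
  have hcont : Continuous fun q : N × ℝ => q.1 * dil q.2 u :=
    continuous_fst.mul ((continuous_dil_left u).comp continuous_snd)
  have h1 : ∀ᵐ p ∂μ, ∀ᵐ s : ℝ, HasDirDeriv f (p * dil s u) u := by
    refine Eventually.of_forall fun p => ?_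
    filter_upwards [(lipschitz_along_horizontal hf hu p).ae_differentiableAt_real] with s hs
    refine ⟨_, (hasDerivAt_iff_tendsto_slope_zero.1 hs.hasDerivAt).congr fun t => ?_⟩
    rw [diffQuot, mul_assoc, ← hu, smul_eq_mul]
  rw [Measure.ae_ae_comm (p := fun p s => HasDirDeriv f (p * dil s u) u)
    (hcont.measurable hm)] at h1
  obtain ⟨s, hs⟩ := h1.exists
  exact (measure_mul_right_null μ (dil s u)).1 hs

/-- Let `E` be the set of points `p` at which the increment of `f` along `δ_t v` is within `ε |t|`
of `t q` for all `|t| < r`. At a density point `p` of `E` there are, for small `t`, points of `E`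
at distance `o(t)` from `p * δ_t u`, and by left-invariance and homogeneity of the distance the
increments along `δ_t v` at these points and at `p * δ_t u` differ by `o(t)`. Countably many sets
`E` cover almost every point. -/
theorem ae_isAdditiveAt (hf : LipschitzWith K f) (u : N) {v : N}
    (hv : ∀ᵐ p ∂μ, HasDirDeriv f p v) : ∀ᵐ p ∂μ, IsAdditiveAt f p u v := by
  have := sigmaCompactSpace N
  have := secondCountableTopology N
  have := isUnifLocDoublingMeasure μ
  let E : ℝ → ℝ → ℝ → Set N := fun ε r q =>
    {p | ∀ t : ℝ, t ≠ 0 → |t| < r → |f (p * dil t v) - f p - t * q| ≤ ε * |t|}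
  have hE : ∀ ε r q, MeasurableSet (E ε r q) := by
    intro ε r q
    refine IsClosed.measurableSet ?_
    simp only [E, ofPred_forall]
    refine isClosed_iInter fun t => isClosed_iInter fun _ => isClosed_iInter fun _ =>
      isClosed_le ?_ continuous_const
    exact (((hf.continuous.comp (continuous_id.mul continuous_const)).sub hf.continuous).sub
      continuous_const).abs
  have hden : ∀ ε r q, 0 < ε → 0 < r → ∀ᵐ p ∂μ, p ∈ E ε r q → ∀ᶠ t in 𝓝[≠] (0 : ℝ),
      |f (p * dil t (u * v)) - f (p * dil t u) - (f (p * dil t v) - f p)| ≤ 4 * ε * |t| := by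
    intro ε r q hε hr
    obtain ⟨η, hη, hη1, hη2⟩ : ∃ η > 0, K * η ≤ ε ∧
        ∀ w : N, dist w 1 ≤ η → K * dist v (w * v) ≤ ε := by
      have h1 : ContinuousAt (fun w : N => K * dist v (w * v)) 1 := by
        exact (continuous_const.mul (continuous_const.dist
          (continuous_id.mul continuous_const))).continuousAt
      have h2 : ∀ᶠ w in 𝓝 (1 : N), K * dist v (w * v) < ε :=
        h1.eventually_lt continuousAt_const (by simpa using hε)
      obtain ⟨δ, hδ, hδ2⟩ := Metric.eventually_nhds_iff_ball.1 h2
      refine ⟨min (δ / 2) (ε / (K + 1)), by positivity, ?_, fun w hw => (hδ2 w ?_).le⟩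
      · calc (K : ℝ) * min (δ / 2) (ε / (K + 1)) ≤ K * (ε / (K + 1)) := by
              gcongr; exact min_le_right _ _
          _ = ε * (K / (K + 1)) := by ring
          _ ≤ ε * 1 := by
              gcongr
              rw [div_le_one (by positivity)]
              linarith
          _ = ε := mul_one ε
      · rw [Metric.mem_ball]
        have := min_le_left (δ / 2) (ε / (K + 1))
        linarith
    -- The balls below are centred at `p * δ_t u` and have radius `η |t|`; they contain `p` after
    -- magnification by `dist u 1 / η`.
    have hdens := IsUnifLocDoublingMeasure.ae_tendsto_measure_inter_div μ (E ε r q)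
      (dist u 1 / η)
    rw [ae_restrict_iff' (hE ε r q)] at hdens
    filter_upwards [hdens] with p hp hpE
    have hlim : Tendsto (fun t : ℝ => η * |t|) (𝓝[≠] 0) (𝓝[>] 0) := by
      refine tendsto_nhdsWithin_iff.2 ⟨?_, ?_⟩
      · have : Continuous fun t : ℝ => η * |t| := by fun_prop
        simpa using (this.tendsto 0).mono_left nhdsWithin_le_nhds
      · filter_upwards [self_mem_nhdsWithin] with t ht
        exact mul_pos hη (abs_pos.2 ht)
    have hpd := hp hpE (l := 𝓝[≠] (0 : ℝ)) (fun t => p * dil t u) (fun t => η * |t|) hlim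
      (Eventually.of_forall fun t => by
        rw [Metric.mem_closedBall, dist_comm, dist_mul_left_self, dist_dil_one]
        field_simp
        exact le_rfl)
    have hne := hpd.eventually_ne (one_ne_zero)
    have hsmall : ∀ᶠ t : ℝ in 𝓝[≠] 0, |t| < r := by
      refine nhdsWithin_le_nhds ?_
      have : Continuous fun t : ℝ => |t| := by fun_prop
      exact (this.tendsto 0).eventually_lt tendsto_const_nhds (by simpa using hr)
    filter_upwards [hne, hsmall, self_mem_nhdsWithin] with t ht htr ht0
    have ht0 : t ≠ 0 := ht0
    have hμ : μ (E ε r q ∩ Metric.closedBall (p * dil t u) (η * |t|)) ≠ 0 := by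
      intro h; rw [h, ENNReal.zero_div] at ht; exact ht rfl
    obtain ⟨x, hxE, hxB⟩ := nonempty_of_measure_ne_zero hμ
    rw [Metric.mem_closedBall] at hxB
    set w : N := dil t⁻¹ ((p * dil t u)⁻¹ * x) with hw
    have hxw : x = p * dil t u * dil t w := by rw [hw, dil_dil_inv ht0]; group
    have hw1 : dist w 1 ≤ η := by
      rw [hxw, dist_mul_left_self, dist_dil_one, mul_comm] at hxB
      exact le_of_mul_le_mul_right hxB (abs_pos.2 ht0)
    have a1 := hpE t ht0 htr
    have a2 := hxE t ht0 htr
    have a3 : |f (p * dil t u) - f x| ≤ ε * |t| := by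
      rw [← Real.dist_eq]
      refine (hf.dist_le_mul _ _).trans ?_
      rw [dist_comm]
      calc (K : ℝ) * dist x (p * dil t u) ≤ K * (η * |t|) := by gcongr
        _ = K * η * |t| := by ring
        _ ≤ ε * |t| := by gcongr
    have a4 : |f (p * dil t (u * v)) - f (x * dil t v)| ≤ ε * |t| := by
      rw [← Real.dist_eq]
      refine (hf.dist_le_mul _ _).trans ?_
      rw [dil_map_mul, hxw, ← mul_assoc, mul_assoc (p * dil t u) (dil t w),
        MetricScalableGroup.dist_mul_left, ← dil_map_mul, MetricScalableGroup.dist_dil]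
      calc (K : ℝ) * (|t| * dist v (w * v)) = K * dist v (w * v) * |t| := by ring
        _ ≤ ε * |t| := by gcongr; exact hη2 w hw1
    rw [abs_le] at a1 a2 a3 a4 ⊢
    constructor <;> linarith [a1.1, a1.2, a2.1, a2.2, a3.1, a3.2, a4.1, a4.2]
  have hall : ∀ᵐ p ∂μ, ∀ (k j : ℕ) (q : ℚ), p ∈ E (1 / (k + 1)) (1 / (j + 1)) q →
      ∀ᶠ t in 𝓝[≠] (0 : ℝ), |f (p * dil t (u * v)) - f (p * dil t u) -
        (f (p * dil t v) - f p)| ≤ 4 * (1 / (k + 1)) * |t| := by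
    rw [ae_all_iff]; intro k
    rw [ae_all_iff]; intro j
    rw [ae_all_iff]; intro q
    exact hden _ _ _ (by positivity) (by positivity)
  filter_upwards [hall, hv] with p hp hpv
  obtain ⟨c, hc⟩ := hpv
  rw [IsAdditiveAt, Metric.tendsto_nhds]
  intro ε hε
  obtain ⟨k, hk⟩ := exists_nat_one_div_lt (show (0 : ℝ) < ε / 4 by positivity)
  set e : ℝ := 1 / (k + 1) with he
  have he0 : 0 < e := by positivity
  obtain ⟨q, hq1, hq2⟩ := exists_rat_btwn (show c < c + e / 2 by linarith)
  have hev : ∀ᶠ t in 𝓝[≠] (0 : ℝ), |f (p * dil t v) - f p - t * q| ≤ e * |t| := by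
    filter_upwards [(Metric.tendsto_nhds.1 hc) (e / 2) (by positivity), self_mem_nhdsWithin]
      with t ht ht0
    have ht0 : t ≠ 0 := ht0
    have h1 : f (p * dil t v) - f p - t * q = t * (diffQuot f p v t - q) := by
      rw [diffQuot]; field_simp
    rw [h1, abs_mul, mul_comm]
    refine mul_le_mul_of_nonneg_right ?_ (abs_nonneg t)
    rw [Real.dist_eq, abs_lt] at ht
    rw [abs_le]
    constructor <;> linarith [ht.1, ht.2]
  obtain ⟨δ, hδ, hδ2⟩ := Metric.mem_nhdsWithin_iff.1 hev
  obtain ⟨j, hj⟩ := exists_nat_one_div_lt hδ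
  have hpE : p ∈ E e (1 / (j + 1)) q := by
    intro t ht0 htj
    refine hδ2 ⟨?_, ht0⟩
    rw [Metric.mem_ball, Real.dist_eq, sub_zero]
    exact htj.trans hj
  filter_upwards [hp k j q hpE, self_mem_nhdsWithin] with t ht ht0
  have ht0 : t ≠ 0 := ht0
  rw [Real.dist_eq, sub_zero]
  have h2 : diffQuot f p (u * v) t - diffQuot f p u t - diffQuot f p v t =
      t⁻¹ * (f (p * dil t (u * v)) - f (p * dil t u) - (f (p * dil t v) - f p)) := by
    simp only [diffQuot]; ring
  rw [h2, abs_mul, abs_inv]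
  calc |t|⁻¹ * |f (p * dil t (u * v)) - f (p * dil t u) - (f (p * dil t v) - f p)|
      ≤ |t|⁻¹ * (4 * e * |t|) := by gcongr
    _ = 4 * e := by
      have : |t| ≠ 0 := abs_ne_zero.2 ht0
      field_simp
    _ < ε := by linarith

/-- The directions of almost everywhere differentiability form a subgroup, which contains the
horizontal elements. -/
theorem ae_hasDirDeriv (hN : Subgroup.closure {u : N | IsHorizontal u} = ⊤)
    (hf : LipschitzWith K f) (u : N) : ∀ᵐ p ∂μ, HasDirDeriv f p u := by
  have hu : u ∈ Subgroup.closure {u : N | IsHorizontal u} := by rw [hN]; trivial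
  induction hu using Subgroup.closure_induction with
  | mem u hu => exact ae_hasDirDeriv_of_isHorizontal μ hf hu
  | one => exact Eventually.of_forall fun p => hasDirDeriv_one f p
  | mul u v _ _ hu hv =>
    filter_upwards [hu, hv, ae_isAdditiveAt μ hf u hv] with p h1 h2 h3
    exact h3.hasDirDeriv_mul h1 h2
  | inv u _ hu =>
    filter_upwards [hu, ae_isAdditiveAt μ hf u⁻¹ hu] with p h1 h2
    exact h2.hasDirDeriv_inv h1

end Diff

/-! ### Negligible sets -/

/-- Resampling one coordinate independently preserves an infinite product measure. -/
theorem measurePreserving_update_infinitePi {ι : Type*} [DecidableEq ι] {X : ι → Type*}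
    [∀ i, MeasurableSpace (X i)] (ν : ∀ i, Measure (X i)) [∀ i, IsProbabilityMeasure (ν i)]
    (m : ι) : MeasurePreserving (fun q : (∀ i, X i) × X m => Function.update q.1 m q.2)
      ((Measure.infinitePi ν).prod (ν m)) (Measure.infinitePi ν) := by
  have hmeas : Measurable (fun q : (∀ i, X i) × X m => Function.update q.1 m q.2) := by
    refine measurable_pi_iff.2 fun i => ?_
    rcases eq_or_ne i m with rfl | h
    · simpa using measurable_snd
    · have : Measurable fun q : (∀ i, X i) × X m => q.1 i :=
        (measurable_pi_apply i).comp measurable_fst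
      simpa [h] using this
  refine ⟨hmeas, Measure.eq_infinitePi ν fun s t ht => ?_⟩
  rw [Measure.map_apply hmeas (MeasurableSet.pi s.countable_toSet fun i _ => ht i)]
  by_cases hm : m ∈ s
  · have h1 : (fun q : (∀ i, X i) × X m => Function.update q.1 m q.2) ⁻¹' (Set.pi s t) =
        (Set.pi (s.erase m : Finset ι) t) ×ˢ (t m) := by
      ext q
      simp only [mem_preimage, Set.mem_pi, Finset.mem_coe, mem_prod, Finset.mem_erase]
      constructor
      · intro h
        refine ⟨fun i hi => ?_, by simpa using h m hm⟩
        simpa [hi.1] using h i hi.2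
      · rintro ⟨hb, ha⟩ i hi
        rcases eq_or_ne i m with rfl | h
        · simpa using ha
        · simpa [h] using hb i ⟨h, hi⟩
    rw [h1, Measure.prod_prod, Measure.infinitePi_pi ν fun i _ => ht i,
      Finset.prod_erase_mul s _ hm]
  · have h1 : (fun q : (∀ i, X i) × X m => Function.update q.1 m q.2) ⁻¹' (Set.pi s t) =
        (Set.pi s t) ×ˢ univ := by
      ext q
      simp only [mem_preimage, Set.mem_pi, Finset.mem_coe, mem_prod, mem_univ, and_true]
      refine forall_congr' fun i => forall_congr' fun hi => ?_
      have h : i ≠ m := fun h => hm (h ▸ hi)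
      simp [h]
    rw [h1, Measure.prod_prod, Measure.infinitePi_pi ν fun i _ => ht i]
    simp

theorem infinitePi_eq_zero_of_slices {ι : Type*} [DecidableEq ι] {X : ι → Type*}
    [∀ i, MeasurableSpace (X i)] (ν : ∀ i, Measure (X i)) [∀ i, IsProbabilityMeasure (ν i)]
    (m : ι) {S : Set (∀ i, X i)} (hS : MeasurableSet S)
    (h : ∀ x, ν m {a | Function.update x m a ∈ S} = 0) : Measure.infinitePi ν S = 0 := by
  have hp := measurePreserving_update_infinitePi ν m
  rw [← hp.measure_preimage hS.nullMeasurableSet, Measure.measure_prod_null (hp.measurable hS)]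
  exact Eventually.of_forall fun x => h x

section Product
variable {G : Type*} [Group G]

/-- The partial products `X_{k-1}(x_{k-1}) ⋯ X_0(x_0)`. -/
def leftProd {E : ℕ → Type*} (X : ∀ m, E m → G) (x : ∀ m, E m) : ℕ → G
  | 0 => 1
  | k + 1 => X k (x k) * leftProd X x k

theorem leftProd_update_of_le {E : ℕ → Type*} (X : ∀ m, E m → G) (x : ∀ m, E m) (m : ℕ) (a : E m)
    {k : ℕ} (hk : k ≤ m) : leftProd X (Function.update x m a) k = leftProd X x k := by
  induction k with
  | zero => rfl
  | succ k ih =>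
    have : k ≠ m := by omega
    simp [leftProd, ih (by omega), this]

/-- The coordinate `m` enters a long product only through the factor `X m`, which stands
immediately to the left of the partial product of the coordinates below `m`. -/
theorem leftProd_update_of_lt {E : ℕ → Type*} (X : ∀ m, E m → G) (x : ∀ m, E m) (m : ℕ) (a : E m)
    {k : ℕ} (hk : m < k) : leftProd X (Function.update x m a) k =
      leftProd X x k * (leftProd X x (m + 1))⁻¹ * X m a * leftProd X x m := by
  induction k, hk using Nat.le_induction with
  | base => simp [leftProd, leftProd_update_of_le]
  | succ k hk ih =>
    have : k ≠ m := by omega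
    rw [leftProd, ih, show leftProd X x (k + 1) = X k (x k) * leftProd X x k from rfl,
      Function.update_of_ne this]
    simp only [mul_assoc]

theorem leftProd_mem {E : ℕ → Type*} (X : ∀ m, E m → G) (x : ∀ m, E m) {N : ℕ → Subgroup G}
    (hN : Monotone N) (hX : ∀ m a, X m a ∈ N m) (k : ℕ) : leftProd X x k ∈ N k := by
  induction k with
  | zero => exact one_mem _
  | succ k ih => exact mul_mem (hN k.le_succ (hX k _)) (hN k.le_succ ih)

theorem exists_small_conj [MetricSpace G] [IsTopologicalGroup G] {K : Set G} (hK : IsCompact K)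
    {ε : ℝ} (hε : 0 < ε) : ∀ᶠ c in 𝓝 (1 : G), ∀ y ∈ K, dist (y⁻¹ * c * y) 1 < ε := by
  refine hK.eventually_forall_of_forall_eventually (P := fun c y => dist (y⁻¹ * c * y) 1 < ε)
    fun y _ => ?_
  have hc : Continuous fun q : G × G => dist (q.2⁻¹ * q.1 * q.2) 1 := by fun_prop
  exact (hc.tendsto (1, y)).eventually_lt tendsto_const_nhds (by simpa using hε)

variable [MetricSpace G] [IsTopologicalGroup G]

theorem exists_compact_small (N : Subgroup G) [LocallyCompactSpace N] {K : Set G}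
    (hK : IsCompact K) {ε : ℝ} (hε : 0 < ε) : ∃ C : Set N, IsCompact C ∧ C ∈ 𝓝 1 ∧
      ∀ c ∈ C, ∀ y ∈ K, dist (y⁻¹ * (c : G) * y) 1 < ε := by
  have h : ∀ᶠ c : N in 𝓝 1, ∀ y ∈ K, dist (y⁻¹ * (c : G) * y) 1 < ε :=
    (continuous_subtype_val.tendsto (1 : N)).eventually (exists_small_conj hK hε)
  obtain ⟨C, hC, hCs, hCc⟩ := local_compact_nhds h
  exact ⟨C, hCc, hC, fun c hc => hCs hc⟩

/-- Compact neighbourhoods `C m` of the identity in `N m`, chosen successively such that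
multiplication on the left by an element of `C m` moves the points of a compact set `K m`
containing all products `c_{m-1} ⋯ c_0` with `c_i ∈ C i` by less than `ε m`. For a left-invariant
distance the displacement of `y` under `c` is the distance from `y⁻¹ * c * y` to the identity. -/
theorem exists_compact_sequence (N : ℕ → Subgroup G) [∀ m, LocallyCompactSpace (N m)]
    {ε : ℕ → ℝ} (hε : ∀ m, 0 < ε m) : ∃ (C : ∀ m, Set (N m)) (K : ℕ → Set G),
      (∀ m, IsCompact (C m)) ∧ (∀ m, C m ∈ 𝓝 1) ∧ 1 ∈ K 0 ∧
      (∀ m, ∀ c ∈ C m, ∀ y ∈ K m, (c : G) * y ∈ K (m + 1)) ∧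
      ∀ m, ∀ c ∈ C m, ∀ y ∈ K m, dist (y⁻¹ * (c : G) * y) 1 < ε m := by
  choose C hC1 hC2 hC3 using fun (m : ℕ) (K : {K : Set G // IsCompact K}) =>
    exists_compact_small (N m) K.2 (hε m)
  let K : ℕ → {K : Set G // IsCompact K} := fun m => Nat.rec ⟨{1}, isCompact_singleton⟩
    (fun k K => ⟨((↑) '' C k K : Set G) * K.1,
      ((hC1 k K).image continuous_subtype_val).mul K.2⟩) m
  refine ⟨fun m => C m (K m), fun m => (K m).1, fun m => hC1 _ _, fun m => hC2 _ _, rfl, ?_,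
    fun m => hC3 _ _⟩
  intro m c hc y hy
  exact Set.mul_mem_mul (mem_image_of_mem _ hc) hy

/-- The law of a random convergent product `⋯ x_2 x_1 x_0` of independent `x_m`, distributed
according to the normalized restrictions of Haar measures to small compact neighbourhoods in `N m`,
is concentrated near the identity, and each of its left translates charges no negligible set. -/
theorem interior_eq_empty_of_isFiltrationNegligible [CompleteSpace G] [SecondCountableTopology G]
    [MeasurableSpace G] [BorelSpace G] (hd : ∀ g x y : G, dist (g * x) (g * y) = dist x y)
    {N : ℕ → Subgroup G} (hN : Monotone N) [∀ m, LocallyCompactSpace (N m)] {Ω : Set G}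
    (hΩ : IsFiltrationNegligible N Ω) : interior Ω = ∅ := by
  classical
  obtain ⟨-, A, hA, rfl, hnull⟩ := hΩ
  by_contra hne
  obtain ⟨p, hp⟩ := nonempty_iff_ne_empty.2 hne
  obtain ⟨r, hr, hball⟩ := Metric.isOpen_iff.1 isOpen_interior p hp
  obtain ⟨C, K, hCc, hC1, hK0, hK, hsmall⟩ := exists_compact_sequence N
    (ε := fun m => r / 2 / 2 / 2 ^ m) (fun m => by positivity)
  have hCm : ∀ m, MeasurableSet (C m) := fun m => (hCc m).measurableSet
  let X : ∀ m, N m → G := fun m a => if a ∈ C m then (a : G) else 1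
  have hXC : ∀ m a, ∃ c ∈ C m, X m a = c := by
    intro m a
    by_cases ha : a ∈ C m
    · exact ⟨a, ha, if_pos ha⟩
    · exact ⟨1, mem_of_mem_nhds (hC1 m), if_neg ha⟩
  have hXm : ∀ m, Measurable (X m) := fun m =>
    Measurable.ite (hCm m) measurable_subtype_coe measurable_const
  have hPK : ∀ x k, leftProd X x k ∈ K k := by
    intro x k
    induction k with
    | zero => exact hK0
    | succ k ih =>
      obtain ⟨c, hc, hXc⟩ := hXC k (x k)
      rw [leftProd, hXc]
      exact hK k c hc _ ih
  have hdist : ∀ x k, dist (leftProd X x k) (leftProd X x (k + 1)) ≤ r / 2 / 2 / 2 ^ k := by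
    intro x k
    obtain ⟨c, hc, hXc⟩ := hXC k (x k)
    have h := hsmall k c hc _ (hPK x k)
    rw [dist_comm, ← hd (leftProd X x k)⁻¹, leftProd, hXc, inv_mul_cancel, ← mul_assoc]
    exact h.le
  have hlim : ∀ x, ∃ y, Tendsto (leftProd X x) atTop (𝓝 y) := fun x =>
    cauchySeq_tendsto_of_complete (cauchySeq_of_le_geometric_two (hdist x))
  choose Y hY using hlim
  have hYball : ∀ x, p * Y x ∈ ⋃ m, A m := by
    intro x
    refine interior_subset (hball ?_)
    have h := dist_le_of_le_geometric_two_of_tendsto₀ (hdist x) (hY x)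
    rw [Metric.mem_ball, dist_comm]
    have hpY : dist p (p * Y x) = dist 1 (Y x) := by simpa using hd p 1 (Y x)
    rw [hpY]
    exact lt_of_le_of_lt h (by linarith)
  have hPm : ∀ k, Measurable fun x => leftProd X x k := by
    intro k
    induction k with
    | zero => exact measurable_const
    | succ k ih => exact ((hXm k).comp (measurable_pi_apply k)).mul ih
  have hYm : Measurable Y := measurable_of_tendsto_metrizable hPm (tendsto_pi_nhds.2 hY)
  have hYu : ∀ x m a, Y (Function.update x m a) =
      Y x * (leftProd X x (m + 1))⁻¹ * X m a * leftProd X x m := by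
    intro x m a
    refine tendsto_nhds_unique (hY _) ?_
    refine ((((hY x).mul_const _).mul_const _).mul_const _).congr' ?_
    filter_upwards [eventually_gt_atTop m] with k hk
    exact (leftProd_update_of_lt X x m a hk).symm
  let ν : ∀ m, Measure (N m) := fun m => ProbabilityTheory.cond Measure.haar (C m)
  have hν : ∀ m, IsProbabilityMeasure (ν m) := fun m =>
    ProbabilityTheory.cond_isProbabilityMeasure_of_finite
      (Measure.measure_pos_of_mem_nhds _ (hC1 m)).ne' (hCc m).measure_lt_top.ne
  have hzero : ∀ m, Measure.infinitePi ν {x | p * Y x ∈ A m} = 0 := by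
    intro m
    refine infinitePi_eq_zero_of_slices ν m ((hYm.const_mul p) (hA m)) fun x => ?_
    set g : G := p * Y x * (leftProd X x (m + 1))⁻¹ with hg
    let R : N m := ⟨leftProd X x m, leftProd_mem X x hN (fun i a => by
      obtain ⟨c, -, hc⟩ := hXC i a
      rw [hc]; exact c.2) m⟩
    have h1 : ν m (C m)ᶜ = 0 := by
      rw [ProbabilityTheory.cond_apply (hCm m), inter_compl_self, measure_empty, mul_zero]
    -- The lower coordinates contribute an element `R` of `N m` on the right, and right translations
    -- preserve the null sets of Haar measure.
    have h2 : ν m ((fun a : N m => a * R) ⁻¹' ((fun x : N m => (x : G)) ⁻¹' (g⁻¹ • A m))) = 0 := by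
      refine ProbabilityTheory.cond_absolutelyContinuous ?_
      rw [measure_mul_right_null]
      exact hnull m g⁻¹ _ inferInstance
    refine measure_mono_null (fun a ha => ?_) (measure_union_null h1 h2)
    by_cases haC : a ∈ C m
    · refine Or.inr ?_
      have ha' : p * Y (Function.update x m a) ∈ A m := ha
      rw [hYu, show X m a = a from if_pos haC] at ha'
      rw [mem_preimage, mem_preimage, Set.mem_inv_smul_set_iff, smul_eq_mul]
      convert! ha' using 1
      simp [hg, R, mul_assoc]
    · exact Or.inl haC
  have huniv : Measure.infinitePi ν univ = 0 := by
    refine measure_mono_null (fun x _ => ?_) (measure_iUnion_null hzero)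
    obtain ⟨m, hm⟩ := mem_iUnion.1 (hYball x)
    exact mem_iUnion.2 ⟨m, hm⟩
  simp at huniv

end Product

/-! ### Extension of derivatives from a dense set of directions -/

section Extend
variable {G : Type*} [Group G] [MetricSpace G] [IsTopologicalGroup G] [ScalableGroup G]
  [MetricScalableGroup G] {K : NNReal} {f : G → ℝ}

theorem dist_diffQuot_le (hf : LipschitzWith K f) (p u v : G) {t : ℝ} (ht : t ≠ 0) :
    dist (diffQuot f p u t) (diffQuot f p v t) ≤ K * dist u v := by
  have h := hf.dist_le_mul (p * dil t u) (p * dil t v)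
  rw [MetricScalableGroup.dist_mul_left, MetricScalableGroup.dist_dil, Real.dist_eq] at h
  have e : diffQuot f p u t - diffQuot f p v t =
      t⁻¹ * (f (p * dil t u) - f (p * dil t v)) := by
    simp only [diffQuot]; ring
  rw [Real.dist_eq, e, abs_mul, abs_inv]
  have ht' : 0 < |t| := abs_pos.2 ht
  calc |t|⁻¹ * |f (p * dil t u) - f (p * dil t v)| ≤ |t|⁻¹ * (K * (|t| * dist u v)) := by gcongr
    _ = K * dist u v := by field_simp

/-- The set of directions in which a Lipschitz function is differentiable at a point is closed. -/
theorem hasDirDeriv_of_dense (hf : LipschitzWith K f) {p : G} {S : Set G} (hS : Dense S)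
    (h : ∀ u ∈ S, HasDirDeriv f p u) (u : G) : HasDirDeriv f p u := by
  refine cauchy_map_iff_exists_tendsto.1 (Metric.cauchy_iff.2 ⟨inferInstance, fun ε hε => ?_⟩)
  obtain ⟨v, hvS, hv⟩ := hS.exists_dist_lt u (show (0 : ℝ) < ε / 4 / (K + 1) by positivity)
  obtain ⟨c, hc⟩ := h v hvS
  have hKv : K * dist u v ≤ ε / 4 := by
    rw [lt_div_iff₀ (by positivity)] at hv
    nlinarith [dist_nonneg (x := u) (y := v)]
  refine ⟨Metric.ball c (ε / 2), ?_, fun x hx y hy => ?_⟩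
  · rw [mem_map]
    filter_upwards [(Metric.tendsto_nhds.1 hc) (ε / 4) (by positivity), self_mem_nhdsWithin]
      with t ht ht0
    have h1 := dist_diffQuot_le hf p u v (show t ≠ 0 from ht0)
    rw [mem_preimage, Metric.mem_ball]
    linarith [dist_triangle (diffQuot f p u t) (diffQuot f p v t) c]
  · rw [Metric.mem_ball] at hx hy
    linarith [dist_triangle_right x y c]

/-- The directional derivative is a Lipschitz function of the direction, so its additivity extends
from a dense set to the whole group. -/
theorem gateauxDifferentiableAt_of_dense (hf : LipschitzWith K f) {p : G} {S : Set G}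
    (hS : Dense S) (h : ∀ u ∈ S, HasDirDeriv f p u)
    (hadd : ∀ u ∈ S, ∀ v ∈ S, IsAdditiveAt f p u v) :
    GateauxDifferentiableAt (fun x : G => Multiplicative.ofAdd (f x)) p := by
  choose D hD using hasDirDeriv_of_dense hf hS h
  have hlip : LipschitzWith K D := LipschitzWith.of_dist_le_mul fun u v => by
    refine le_of_tendsto ((hD u).dist (hD v)) ?_
    filter_upwards [self_mem_nhdsWithin] with t ht
    exact dist_diffQuot_le hf p u v ht
  have hmul : ∀ q : G × G, D (q.1 * q.2) = D q.1 + D q.2 := by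
    have hcl : IsClosed {q : G × G | D (q.1 * q.2) = D q.1 + D q.2} := by
      have := hlip.continuous
      exact isClosed_eq (by fun_prop) (by fun_prop)
    have hsub : S ×ˢ S ⊆ {q : G × G | D (q.1 * q.2) = D q.1 + D q.2} := by
      rintro ⟨u, v⟩ ⟨hu, hv⟩
      have := tendsto_nhds_unique (hadd u hu v hv) (((hD (u * v)).sub (hD u)).sub (hD v))
      change D (u * v) = D u + D v
      linarith
    intro q
    have := (hcl.closure_subset_iff.2 hsub)
    rw [(hS.prod hS).closure_eq] at this
    exact this (mem_univ q)
  refine ⟨⟨MonoidHom.mk' (fun u => Multiplicative.ofAdd (D u)) fun u v => ?_,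
    continuous_ofAdd.comp hlip.continuous⟩, fun u => ?_⟩
  · rw [hmul (u, v), ofAdd_add]
  · refine ((continuous_ofAdd.tendsto (D u)).comp (hD u)).congr fun t => ?_
    change Multiplicative.ofAdd (diffQuot f p u t) =
      Multiplicative.ofAdd (1 / t * (-f p + f (p * dil t u)))
    rw [diffQuot]
    congr 1
    ring
end Extend

/-! ### Filtrations by Carnot subgroups -/

section Filtration
variable {G : Type*} [Group G] [MetricSpace G] [IsTopologicalGroup G] [ScalableGroup G]
  {N : ℕ → Subgroup G}

theorem IsCarnotFiltration.locallyCompactSpace (hN : IsCarnotFiltration N) (m : ℕ) :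
    LocallyCompactSpace (N m) :=
  letI := (hN.isScalable m).scalableGroup
  (hN.hasCarnot m).locallyCompactSpace

theorem IsCarnotFiltration.secondCountableTopology (hN : IsCarnotFiltration N) :
    SecondCountableTopology G := by
  have hsep : TopologicalSpace.IsSeparable (⋃ m, (N m : Set G)) := by
    refine TopologicalSpace.IsSeparable.iUnion fun m => ?_
    let := (hN.isScalable m).scalableGroup
    have := hN.locallyCompactSpace m
    have := ScalableGroup.secondCountableTopology (N m)
    exact TopologicalSpace.IsSeparable.of_subtype _
  have h := hsep.closure
  rw [hN.closure_eq, TopologicalSpace.isSeparable_univ_iff] at h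
  exact UniformSpace.secondCountable_of_separable G

theorem diffQuot_comp_coe {H : Subgroup G} (hH : IsScalableSubgroup H) (f : G → ℝ) (g : G)
    (x u : H) :
    letI := hH.scalableGroup
    diffQuot (fun y : H => f (g * y)) x u = diffQuot f (g * x) (u : G) := by
  let := hH.scalableGroup
  funext t
  simp only [diffQuot, Subgroup.coe_mul, mul_assoc]
  rfl

/-- The points at which a directional derivative of `f` in a direction of `S`, or the additivity of
the difference quotients in two such directions, fails. -/
def nonDiffSet (f : G → ℝ) (S : Set G) : Set G :=
  (⋃ u ∈ S, {p | HasDirDeriv f p u}ᶜ) ∪ ⋃ u ∈ S, ⋃ v ∈ S, {p | IsAdditiveAt f p u v}ᶜ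

theorem measurableSet_nonDiffSet [MeasurableSpace G] [BorelSpace G] {f : G → ℝ}
    (hf : Continuous f) {S : Set G} (hS : S.Countable) : MeasurableSet (nonDiffSet f S) :=
  (MeasurableSet.biUnion hS fun u _ => (measurableSet_hasDirDeriv hf u).compl).union
    (MeasurableSet.biUnion hS fun u _ => MeasurableSet.biUnion hS fun v _ =>
      (measurableSet_isAdditiveAt hf u v).compl)

variable [MetricScalableGroup G]

theorem IsScalableSubgroup.metricScalableGroup {H : Subgroup G} (hH : IsScalableSubgroup H) :
    letI := hH.scalableGroup
    MetricScalableGroup H :=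
  letI := hH.scalableGroup
  { dist_mul_left := fun g x y => MetricScalableGroup.dist_mul_left (g : G) x y
    dist_dil := fun t x y => MetricScalableGroup.dist_dil t (x : G) y }

/-- A form of the Pansu–Rademacher theorem on the left cosets of a Carnot subgroup. -/
theorem measure_preimage_smul_nonDiffSet [MeasurableSpace G] [BorelSpace G] {H : Subgroup G}
    [LocallyCompactSpace H]
    (hH : IsScalableSubgroup H) (hC : letI := hH.scalableGroup; HasCarnotGroupStructure H)
    {K : NNReal} {f : G → ℝ} (hf : LipschitzWith K f) {S : Set G} (hS : S.Countable)
    (hSH : S ⊆ H) (g : G) (vol : Measure H) [vol.IsHaarMeasure] :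
    vol ((fun x : H => (x : G)) ⁻¹' (g • nonDiffSet f S)) = 0 := by
  let := hH.scalableGroup
  have := hH.metricScalableGroup
  have hgf : LipschitzWith K fun y : H => f (g⁻¹ * y) :=
    LipschitzWith.of_dist_le_mul fun x y => by
      refine (hf.dist_le_mul _ _).trans ?_
      rw [MetricScalableGroup.dist_mul_left]
      rfl
  have hdir : ∀ u ∈ S, ∀ᵐ x : H ∂vol, HasDirDeriv f (g⁻¹ * x) u := by
    intro u hu
    filter_upwards [ae_hasDirDeriv vol hC.closure_isHorizontal hgf ⟨u, hSH hu⟩] with x hx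
    rwa [HasDirDeriv, diffQuot_comp_coe hH] at hx
  have hadd : ∀ u ∈ S, ∀ v ∈ S, ∀ᵐ x : H ∂vol, IsAdditiveAt f (g⁻¹ * x) u v := by
    intro u hu v hv
    filter_upwards [ae_isAdditiveAt vol hgf ⟨u, hSH hu⟩
      (ae_hasDirDeriv vol hC.closure_isHorizontal hgf ⟨v, hSH hv⟩)] with x hx
    rwa [IsAdditiveAt, diffQuot_comp_coe hH, diffQuot_comp_coe hH, diffQuot_comp_coe hH] at hx
  have h1 := (ae_ball_iff hS).2 hdir
  have h2 := (ae_ball_iff hS).2 fun u hu => (ae_ball_iff hS).2 (hadd u hu)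
  have h3 : ∀ᵐ x : H ∂vol, x ∉ (fun x : H => (x : G)) ⁻¹' (g • nonDiffSet f S) := by
    filter_upwards [h1, h2] with x hx1 hx2 hx
    rw [mem_preimage, Set.mem_smul_set_iff_inv_smul_mem, smul_eq_mul] at hx
    rcases hx with hx | hx
    · simp only [mem_iUnion] at hx
      obtain ⟨u, hu, hx⟩ := hx
      exact hx (hx1 u hu)
    · simp only [mem_iUnion] at hx
      obtain ⟨u, hu, v, hv, hx⟩ := hx
      exact hx (hx2 u hu v hv)
  rw [ae_iff] at h3
  simp only [not_not] at h3
  exact h3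

end Filtration

theorem proposition1p6 {G : Type u} [Group G] [MetricSpace G] [IsTopologicalGroup G]
    [ScalableGroup G] [MetricScalableGroup G] [CompleteSpace G]
    [MeasurableSpace G] [BorelSpace G]
    (N : ℕ → Subgroup G) (hN : IsCarnotFiltration N) :
    (∀ Ω : Set G, IsFiltrationNegligible N Ω → interior Ω = ∅) ∧
    (∀ f : G → ℝ, (∃ K : NNReal, LipschitzWith K f) →
      ∃ p : G, GateauxDifferentiableAt (fun x : G => Multiplicative.ofAdd (f x)) p) := by
  have hlc := hN.locallyCompactSpace
  have hsc := hN.secondCountableTopology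
  have hmono : Monotone N := monotone_nat_of_le_succ hN.le_succ
  have hempty : ∀ Ω : Set G, IsFiltrationNegligible N Ω → interior Ω = ∅ := fun Ω hΩ =>
    interior_eq_empty_of_isFiltrationNegligible MetricScalableGroup.dist_mul_left hmono hΩ
  refine ⟨hempty, ?_⟩
  rintro f ⟨K, hf⟩
  -- A single countable set is used for all `m`, so that any two of its elements lie in a common
  -- `N m`.
  obtain ⟨S, hSN, hSc, hSd⟩ := Dense.exists_countable_dense_subset
    (s := ⋃ m, (N m : Set G)) (dense_iff_closure_eq.2 hN.closure_eq)
  have hm : ∀ m, MeasurableSet (nonDiffSet f (S ∩ N m)) := fun m =>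
    measurableSet_nonDiffSet hf.continuous (hSc.mono inter_subset_left)
  have hneg : IsFiltrationNegligible N (⋃ m, nonDiffSet f (S ∩ N m)) :=
    ⟨MeasurableSet.iUnion hm, _, hm, rfl, fun m g vol _ =>
      measure_preimage_smul_nonDiffSet (hN.isScalable m) (hN.hasCarnot m) hf
        (hSc.mono inter_subset_left) inter_subset_right g vol⟩
  obtain ⟨p, hp⟩ : ∃ p, p ∉ ⋃ m, nonDiffSet f (S ∩ N m) := by
    by_contra! hcon
    have h := hempty _ hneg
    rw [eq_univ_of_forall hcon, interior_univ] at h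
    exact univ_nonempty.ne_empty h
  refine ⟨p, gateauxDifferentiableAt_of_dense hf hSd (fun u hu => ?_) fun u hu v hv => ?_⟩
  · obtain ⟨m, hum⟩ := mem_iUnion.1 (hSN hu)
    by_contra hcon
    exact hp (mem_iUnion.2 ⟨m, Or.inl (mem_biUnion (show u ∈ S ∩ N m from ⟨hu, hum⟩) hcon)⟩)
  · obtain ⟨i, hui⟩ := mem_iUnion.1 (hSN hu)
    obtain ⟨j, hvj⟩ := mem_iUnion.1 (hSN hv)
    by_contra hcon
    exact hp (mem_iUnion.2 ⟨max i j, Or.inr (mem_biUnion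
      (show u ∈ S ∩ N (max i j) from ⟨hu, hmono (le_max_left i j) hui⟩)
      (mem_biUnion (show v ∈ S ∩ N (max i j) from ⟨hv, hmono (le_max_right i j) hvj⟩) hcon))⟩)
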